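/- Let $r\ge 2$ and let $\alpha_1=\epsilon_1+\epsilon_2$, $\alpha_u=\epsilon_u-\epsilon_{u-1}$ ($1<u\le r$) be the simple roots of type $D_r$. Let $\mathfrak n$ be the complex Lie algebra with generators $f_1,\dots,f_r$ subject to the Serre relations $(\operatorname{ad} f_u)^{1-(\alpha_u,\alpha_v)}f_v=0$ ($u\ne v$), let $U(\mathfrak n)$ be its universal enveloping algebra, let $U_r$ be the free associative algebra on $\tilde f_1,\dots,\tilde f_r$, and let $q:U_r\to U(\mathfrak n)$ be the homomorphism with $q(\tilde f_u)=f_u$. For $k\in\mathbb N^r$ put $|k|=\sum_u k_u$ and let $\mathrm{Sym}_k$ be the sum over all permutations in $\prod_u\Sigma_{k_u}$ acting on the variables $t^{(u)}_1,\dots,t^{(u)}_{k_u}$, $1\le u\le r$. The canonical differential form of weight $k$ is $$\Omega_k=\sum_J \mathrm{Sym}_k\Big(\prod_{s=1}^{|k|}\frac1{t_s-t_{s-1}}\Big)\,dV_k\otimes \tilde f_{J(|k|)}\cdots\tilde f_{J(2)}\tilde f_{J(1)},\qquad t_0=0,$$ where $dV_k$ is the standard volume form, $J$ runs over the maps $\{1,\dots,|k|\}\to\{1,\dots,r\}$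 with $\#J^{-1}(u)=k_u$ for all $u$, and $t_s=t^{(J(s))}_{c(s)}$ with $c(s)=\#\{s'\le s: J(s')=J(s)\}$. Let $\Omega^{\mathfrak g}_k=(\mathrm{id}\otimes q)\,\Omega_k$. The positive roots are $\epsilon_j-\epsilon_i$ and $\epsilon_j+\epsilon_i$, $1\le i<j\le r$. The content of a positive root is its coefficient vector in the simple roots, that is, $\epsilon_j-\epsilon_i=\sum_{u=i+1}^j\alpha_u$, $\epsilon_j+\epsilon_1=\alpha_1+\sum_{u=3}^j\alpha_u$, and $\epsilon_j+\epsilon_i=\alpha_1+\alpha_2+2\sum_{u=3}^i\alpha_u+\sum_{u=i+1}^j\alpha_u$ for $1<i<j$. Order the positive roots so that a root with smaller $j$ comes first and, for $i'<i<j$, $\epsilon_j+\epsilon_i<\epsilon_j+\epsilon_{i'}<\epsilon_j-\epsilon_{i'}<\epsilon_j-\epsilon_i$; write $\beta_1<\dots<\beta_m$ for all of them. With $[f_{(J(1),\dots,J(n))}]=[f_{J(1)},[f_{J(2)},[\dots,[f_{J(n-1)},f_{J(n)}]\dots]]]$ put $$F_{\epsilon_j-\epsilon_i}=[f_{(j,j-1,\dots,i+1)}],\quad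 F_{\epsilon_j+\epsilon_1}=[f_{(j,j-1,\dots,3,1)}],\quad F_{\epsilon_j+\epsilon_i}=\big[[f_{(j,j-1,\dots,2)}],[f_{(1,3,4,\dots,i)}]\big]\ (1<i<j).$$ For a positive root $\beta$ with content $k$, let the atom $\eta_\beta$ be the coefficient $\omega_p$, for the exponent $p$ with $F_{\beta_1}^{p_1}\cdots F_{\beta_m}^{p_m}=F_\beta$ (i.e. $p_\beta=1$ and all other entries zero), in an expansion $$\Omega^{\mathfrak g}_k=\sum_p\omega_p\,dV_k\otimes F_{\beta_1}^{p_1}\cdots F_{\beta_m}^{p_m},$$ where the sum is over the $p\in\mathbb N^m$ such that the monomial has content $k$ and the $\omega_p$ are rational functions. **Theorem.** The atoms exist, are uniquely determined, and are given by $$\eta_{\epsilon_j-\epsilon_i}=\frac1{t^{(i+1)}_1\prod_{u=i+2}^{j}(t^{(u)}_1-t^{(u-1)}_1)}\qquad(1\le i<j\le r),$$ $$\eta_{\epsilon_j+\epsilon_1}=\frac1{t^{(1)}_1\,(t^{(3)}_1-t^{(1)}_1)\prod_{u=4}^{j}(t^{(u)}_1-t^{(u-1)}_1)}\quad(3\le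 j\le r),\qquad \eta_{\epsilon_2+\epsilon_1}=\frac1{t^{(1)}_1},$$ and, with $k$ the content of $\epsilon_j+\epsilon_i$, for $3\le i<j\le r$, $$\eta_{\epsilon_j+\epsilon_i}=\mathrm{Sym}_k\,\frac{t^{(3)}_1-t^{(3)}_2}{t^{(i)}_2\,(t^{(1)}_1-t^{(3)}_2)(t^{(2)}_1-t^{(3)}_2)(t^{(3)}_1-t^{(1)}_1)(t^{(3)}_1-t^{(2)}_1)\prod_{u=3}^{i-1}(t^{(u)}_2-t^{(u+1)}_2)\prod_{u=4}^{j}(t^{(u)}_1-t^{(u-1)}_1)},$$ while for $2=i<j\le r$ (where $\mathrm{Sym}_k$ is trivial) $$\eta_{\epsilon_j+\epsilon_2}=\mathrm{Sym}_k\,\frac{t^{(3)}_1}{t^{(1)}_1\,t^{(2)}_1\,(t^{(3)}_1-t^{(1)}_1)(t^{(3)}_1-t^{(2)}_1)\prod_{u=4}^{j}(t^{(u)}_1-t^{(u-1)}_1)}.$$ -/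

import Mathlib

open scoped TensorProduct

noncomputable section

namespace TypeD

/-- The index set `{1, …, r}` of the simple roots. -/
abbrev Idx (r : ℕ) : Type := {u : ℕ // u ∈ Finset.Icc 1 r}

/-! ### The nilpotent Lie algebra and its enveloping algebra -/

/-- The simple roots of type `D_r` as vectors with coordinates numbered `1, 2, …`:
`α_1 = ε_1 + ε_2` and `α_u = ε_u - ε_{u-1}` for `u > 1`. -/
def simpleRoot (u : ℕ) : ℕ → ℤ :=
  if u = 1 then Pi.single 1 1 + Pi.single 2 1 else Pi.single u 1 - Pi.single (u - 1) 1

/-- The Cartan integers `2 (α_u, α_v) / (α_u, α_u)`; since all roots have squared length `2`,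
these are the inner products `(α_u, α_v)`. -/
def cartan (r : ℕ) : Matrix (Idx r) (Idx r) ℤ :=
  Matrix.of fun u v => ∑ a ∈ Finset.Icc 1 r, simpleRoot u a * simpleRoot v a

/-- The left-hand sides `(ad f_u)^{1 - a_{uv}} f_v` of the Serre relations
(for `u = v` this is `⁅f_u, f_u⁆ = 0`). -/
def serre (r : ℕ) (u v : Idx r) : FreeLieAlgebra ℂ (Idx r) :=
  ((LieAlgebra.ad ℂ (FreeLieAlgebra ℂ (Idx r)) (FreeLieAlgebra.of ℂ u)) ^ (-cartan r u v).toNat)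
    ⁅FreeLieAlgebra.of ℂ u, FreeLieAlgebra.of ℂ v⁆

/-- The ideal generated by the Serre relations. -/
def serreIdeal (r : ℕ) : LieIdeal ℂ (FreeLieAlgebra ℂ (Idx r)) :=
  LieSubmodule.lieSpan ℂ _ (Set.range fun x : Idx r × Idx r => serre r x.1 x.2)

/-- The nilpotent part `𝔫` of the Lie algebra of type `D_r`: Chevalley generators `f_1, …, f_r`
subject to the Serre relations. -/
abbrev Nil (r : ℕ) : Type := FreeLieAlgebra ℂ (Idx r) ⧸ serreIdeal r

/-- The universal enveloping algebra `U(𝔫)`. -/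
abbrev UNil (r : ℕ) : Type := UniversalEnvelopingAlgebra ℂ (Nil r)

/-- The Chevalley generator `f_u`, for `1 ≤ u ≤ r` (and `0` for other, never used, `u`). -/
def gen (r : ℕ) (u : ℕ) : Nil r :=
  if h : u ∈ Finset.Icc 1 r then LieSubmodule.Quotient.mk (FreeLieAlgebra.of ℂ ⟨u, h⟩) else 0

/-- The quotient map `q : U_r → U(𝔫)`, `f̃_u ↦ f_u`, from the free associative algebra. -/
def quotMap (r : ℕ) : FreeAlgebra ℂ (Idx r) →ₐ[ℂ] UNil r :=
  FreeAlgebra.lift ℂ fun u => UniversalEnvelopingAlgebra.ι ℂ (gen r u)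

/-! ### Rational functions and symmetrization -/

/-- The field of rational functions in variables `t^{(u)}_a`; the rational functions in
`t^{(u)}_1, …, t^{(u)}_{k_u}`, for the various `k ∈ ℕ^r`, all lie in it. -/
abbrev RatFun (r : ℕ) : Type := FractionRing (MvPolynomial (Idx r × ℕ) ℂ)

/-- The variable `t^{(u)}_a`, for `1 ≤ u ≤ r` (and `0` for other, never used, `u`). -/
def t (r : ℕ) (u a : ℕ) : RatFun r :=
  if h : u ∈ Finset.Icc 1 r then
    algebraMap (MvPolynomial (Idx r × ℕ) ℂ) (RatFun r) (MvPolynomial.X (⟨u, h⟩, a))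
  else 0

/-- The group `G_k = ∏_u Σ_{k_u}`. -/
abbrev SymGroup {r : ℕ} (k : Idx r → ℕ) : Type :=
  (u : Idx r) → Equiv.Perm {a : ℕ // a ∈ Finset.Icc 1 (k u)}

/-- `π ∈ G_k` permutes `t^{(u)}_1, …, t^{(u)}_{k_u}` by its component `π_u`. -/
def permVars {r : ℕ} {k : Idx r → ℕ} (π : SymGroup k) : Equiv.Perm (Idx r × ℕ) :=
  Equiv.prodCongrRight fun u => Equiv.Perm.ofSubtype (π u)

/-- The action of `π ∈ G_k` on rational functions. -/
def permAct {r : ℕ} {k : Idx r → ℕ} (π : SymGroup k) : RatFun r ≃+* RatFun r :=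
  IsFractionRing.ringEquivOfRingEquiv
    (MvPolynomial.renameEquiv ℂ (permVars π)).toRingEquiv

/-- The symmetrizer `Sym_k`. -/
def sym {r : ℕ} (k : Idx r → ℕ) (x : RatFun r) : RatFun r :=
  ∑ π : SymGroup k, permAct π x

/-! ### The canonical differential form -/

/-- The multi-indices `J : {1, …, |k|} → {1, …, r}` with `#J⁻¹(u) = k_u`. The positions
`1, …, |k|` are numbered from `0` here. -/
def multiIndices {r : ℕ} (k : Idx r → ℕ) : Finset (Fin (∑ u, k u) → Idx r) :=
  Finset.univ.filter fun J => ∀ u, (Finset.univ.filter fun s => J s = u).card = k u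

/-- The number `c(s)`: the restriction of `c` to each fibre `J⁻¹(u)` is the increasing bijection
onto `{1, …, k_u}`. -/
def position {r n : ℕ} (J : Fin n → Idx r) (s : Fin n) : ℕ :=
  (Finset.univ.filter fun s' => s' ≤ s ∧ J s' = J s).card

/-- The variable `t_s = t^{(J(s))}_{c(s)}` attached to the position `s` by `J`. -/
def posVar {r n : ℕ} (J : Fin n → Idx r) (s : Fin n) : RatFun r :=
  t r (J s) (position J s)

/-- The variable attached to the position before `s`; it is `t_0 = 0` for the first position. -/
def prevVar {r n : ℕ} (J : Fin n → Idx r) (s : Fin n) : RatFun r :=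
  if h : (s : ℕ) = 0 then 0 else posVar J ⟨s - 1, by omega⟩

/-- The product `∏_{s=1}^{|k|} 1 / (t_s - t_{s-1})`. -/
def chainFun {r n : ℕ} (J : Fin n → Idx r) : RatFun r :=
  ∏ s : Fin n, 1 / (posVar J s - prevVar J s)

/-- The monomial `f̃_J = f̃_{J(|k|)} ⋯ f̃_{J(2)} f̃_{J(1)}`. -/
def freeMonomial {r n : ℕ} (J : Fin n → Idx r) : FreeAlgebra ℂ (Idx r) :=
  (List.ofFn fun s => FreeAlgebra.ι ℂ (J s)).reverse.prod

/-- The canonical differential form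
`Ω_k = ∑_J Sym_k (∏_s 1 / (t_s - t_{s-1})) dV_k ⊗ f̃_J`. A top degree form `φ dV_k` is recorded
by its coefficient, the rational function `φ`. -/
def canonicalForm {r : ℕ} (k : Idx r → ℕ) : RatFun r ⊗[ℂ] FreeAlgebra ℂ (Idx r) :=
  ∑ J ∈ multiIndices k, sym k (chainFun J) ⊗ₜ[ℂ] freeMonomial J

/-- The canonical differential form `Ω_k^𝔤 = (id ⊗ q) Ω_k` of the Lie algebra of type `D_r`. -/
def canonicalFormD {r : ℕ} (k : Idx r → ℕ) : RatFun r ⊗[ℂ] UNil r :=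
  (quotMap r).toLinearMap.lTensor (RatFun r) (canonicalForm k)

/-! ### Positive roots, their order, and the root vectors -/

/-- The positive roots `ε_j + ε_i` (`plus = true`) and `ε_j - ε_i` (`plus = false`),
`1 ≤ i < j ≤ r`. -/
@[ext]
structure PosRoot (r : ℕ) where
  plus : Bool
  i : ℕ
  j : ℕ
  one_le : 1 ≤ i
  lt : i < j
  le : j ≤ r

/-- The sort key of a root: the pair `(j, -i)` for `ε_j + ε_i`, the pair `(j, i)` for
`ε_j - ε_i`, compared lexicographically. -/
def PosRoot.key {r : ℕ} (β : PosRoot r) : ℕ ×ₗ ℤ :=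
  toLex (β.j, if β.plus then -(β.i : ℤ) else (β.i : ℤ))

theorem PosRoot.key_injective (r : ℕ) :
    Function.Injective (PosRoot.key : PosRoot r → ℕ ×ₗ ℤ) := by
  rintro ⟨s, i, j, h1, h2, h3⟩ ⟨s', i', j', h1', h2', h3'⟩ h
  simp only [PosRoot.key, EmbeddingLike.apply_eq_iff_eq, Prod.mk.injEq] at h
  obtain ⟨hj, hi⟩ := h
  cases s <;> cases s' <;> simp at hi ⊢ <;> omega

/-- The linear order on the positive roots: `β < β'` if `j < j'`, and
`ε_j + ε_i < ε_j + ε_{i'} < ε_j - ε_{i'} < ε_j - ε_i` for `i' < i < j`. -/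
instance PosRoot.instLinearOrder (r : ℕ) : LinearOrder (PosRoot r) :=
  LinearOrder.lift' PosRoot.key (PosRoot.key_injective r)

instance PosRoot.instFintype (r : ℕ) : Fintype (PosRoot r) :=
  Fintype.ofInjective
    (fun β : PosRoot r => (β.plus, (⟨β.i, by have := β.lt; have := β.le; omega⟩ : Fin (r + 1)),
      (⟨β.j, by have := β.le; omega⟩ : Fin (r + 1))))
    (by
      intro β γ h
      simp only [Prod.mk.injEq, Fin.mk.injEq] at h
      exact PosRoot.ext h.1 h.2.1 h.2.2)

/-- The coefficients of a positive root with respect to the simple roots: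
`ε_j - ε_i = ∑_{u=i+1}^j α_u`, `ε_j + ε_1 = α_1 + ∑_{u=3}^j α_u`, and
`ε_j + ε_i = α_1 + α_2 + 2 ∑_{u=3}^i α_u + ∑_{u=i+1}^j α_u` for `1 < i`. -/
def PosRoot.content {r : ℕ} (β : PosRoot r) (u : Idx r) : ℕ :=
  if β.plus = false then (if β.i < u ∧ (u : ℕ) ≤ β.j then 1 else 0)
  else if β.i = 1 then (if (u : ℕ) = 1 ∨ 3 ≤ (u : ℕ) ∧ (u : ℕ) ≤ β.j then 1 else 0)
  else if (u : ℕ) ≤ 2 then 1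
  else if (u : ℕ) ≤ β.i then 2
  else if (u : ℕ) ≤ β.j then 1
  else 0

/-- The iterated bracket `[f_{J(1)}, [f_{J(2)}, […, [f_{J(n-1)}, f_{J(n)}] …]]]` for a list
`J = (J(1), …, J(n))`. -/
def iterBracket (r : ℕ) : List ℕ → Nil r
  | [] => 0
  | [u] => gen r u
  | u :: v :: l => ⁅gen r u, iterBracket r (v :: l)⁆

/-- The root vectors: `F_{ε_j - ε_i} = [f_{(j, j-1, …, i+1)}]`,
`F_{ε_j + ε_1} = [f_{(j, j-1, …, 3, 1)}]`, and
`F_{ε_j + ε_i} = [[f_{(j, j-1, …, 2)}], [f_{(1, 3, 4, …, i)}]]` for `1 < i`. -/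
def PosRoot.vec {r : ℕ} (β : PosRoot r) : Nil r :=
  if β.plus = false then iterBracket r (List.Ico (β.i + 1) (β.j + 1)).reverse
  else if β.i = 1 then iterBracket r ((List.Ico 3 (β.j + 1)).reverse ++ [1])
  else ⁅iterBracket r (List.Ico 2 (β.j + 1)).reverse, iterBracket r (1 :: List.Ico 3 (β.i + 1))⁆

/-! ### The Poincaré–Birkhoff–Witt expansion and its atoms -/

/-- The monomial `F^p = F_{β_1}^{p_1} F_{β_2}^{p_2} ⋯ F_{β_m}^{p_m}` in `U(𝔫)`, where
`β_1 < β_2 < … < β_m` are the positive roots. -/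
def pbwMonomial {r : ℕ} (p : PosRoot r → ℕ) : UNil r :=
  (((Finset.univ : Finset (PosRoot r)).sort (· ≤ ·)).map
    fun β => UniversalEnvelopingAlgebra.ι ℂ β.vec ^ p β).prod

/-- The content of `F^p`. -/
def pbwContent {r : ℕ} (p : PosRoot r → ℕ) (u : Idx r) : ℕ :=
  ∑ β : PosRoot r, p β * β.content u

/-- `Ω_k^𝔤 = ∑_p ω_p dV_k ⊗ F^p`, summed over the `p` such that `F^p` has content `k`. -/
def IsPBWExpansion {r : ℕ} (k : Idx r → ℕ) (ω : (PosRoot r → ℕ) →₀ RatFun r) : Prop :=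
  (∀ p ∈ ω.support, pbwContent p = k) ∧
    canonicalFormD k = ω.sum fun p x => x ⊗ₜ[ℂ] pbwMonomial p

/-- `η` is an atom at the positive root `β`: it is the coefficient `ω_p` of the monomial
`F^p = F_β` in an expansion of the canonical form of weight the content of `β`. -/
def IsAtom {r : ℕ} (β : PosRoot r) (η : RatFun r) : Prop :=
  ∃ ω : (PosRoot r → ℕ) →₀ RatFun r, IsPBWExpansion β.content ω ∧ ω (Pi.single β 1) = η

end TypeD

end

/-!
The enveloping algebra acts on the vector representation of `D_r`, with basis vectors `e_a`,
`1 ≤ |a| ≤ r`, and the atom at a root is read off from one matrix coefficient of it.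

*Extracting the atom.* For `β = ε_j - ε_i` put `a = i`, and for `β = ε_j + ε_i` put `a = -i`. The
root vector `F_β` maps `e_a` to `± e_j`, and the coefficient of `e_j` in `x e_a` vanishes for every
other ordered monomial `x` of the same content: as the roots are ordered by `j` first, the
rightmost factor of `x` belongs to a root `ε_j ± ε_{i'}` with the same `j`, and it kills `e_a`
unless the root is `β` (`matCoeff_pbwMonomial_of_ne`). Applied to an expansion of the canonical
form, this matrix coefficient leaves the atom on one side, and on the other the sum of the
symmetrized chains of those words `J` whose monomial moves `e_a` to `e_j` (`isAtom_iff`). In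
particular the atom is unique; linear independence of all ordered monomials is not needed.

*Existence.* The Serre relations imply that the bracket of a Chevalley generator with a root vector
is a combination of root vectors of the right content (`isHomogeneous_gen`). Hence so is the bracket
of two root vectors, and sorting the factors of a monomial changes it only by shorter monomials of
the same content (`prod_mem_of_straighten`, `exists_isPBWExpansion`).

*The words.* From `e_i` to `e_j`, and from `e_{-1}` to `e_j`, there is a single path in the vector
representation. From `e_{-i}` with `i ≥ 2` the path leads down to `e_{-2}`, then to `e_2` through
`e_{-1}` or through `e_1`, and up to `e_j`; so there are two words, which differ by the order of the
letters `1` and `2` (`coeff_wordOp_neg`). Their chains add up by a partial fraction identity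
(`partial_fractions`). Exchanging `t^{(u)}_1` and `t^{(u)}_2` for `3 ≤ u ≤ i`, which the
symmetrization does not see, gives the stated fraction.
-/

namespace TypeD

/-! ### Iterated brackets in Lie algebras with Serre relations -/

section Chain

variable {L : Type*} [LieRing L]

theorem eq_zero_of_eq_neg [LieAlgebra ℂ L] {x : L} (h : x = -x) : x = 0 := by
  have h2 : (2 : ℂ) • x = 0 := by
    rw [two_smul]
    nth_rewrite 1 [h]
    exact neg_add_cancel x
  exact (smul_eq_zero.mp h2).resolve_left two_ne_zero

/-- The Serre relation `(ad x)² y = 0` says that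
`(ad x)² ad y - 2 (ad x) (ad y) (ad x) + (ad y) (ad x)² = 0`; on a vector `z` killed by `ad y` and
by `(ad x)²` only the middle term is left. -/
theorem lie_lie_lie_eq_zero_of_serre [LieAlgebra ℂ L] {x y z : L} (hxy : ⁅x, ⁅x, y⁆⁆ = 0)
    (hyz : ⁅y, z⁆ = 0) (hxz : ⁅x, ⁅x, z⁆⁆ = 0) : ⁅x, ⁅y, ⁅x, z⁆⁆⁆ = 0 := by
  have h1 : ⁅y, ⁅x, z⁆⁆ = ⁅⁅y, x⁆, z⁆ := by
    rw [leibniz_lie y x z, hyz, lie_zero, add_zero]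
  have h2 : ⁅x, ⁅y, x⁆⁆ = 0 := by
    rw [← lie_skew y, lie_neg, hxy, neg_zero]
  have h3 : ⁅x, ⁅⁅y, x⁆, z⁆⁆ = ⁅⁅y, x⁆, ⁅x, z⁆⁆ := by
    rw [leibniz_lie x ⁅y, x⁆ z, h2, zero_lie, zero_add]
  have h4 : ⁅⁅y, x⁆, ⁅x, z⁆⁆ = -⁅x, ⁅y, ⁅x, z⁆⁆⁆ := by
    rw [lie_lie, hxz, lie_zero, zero_sub]
  apply eq_zero_of_eq_neg
  calc ⁅x, ⁅y, ⁅x, z⁆⁆⁆ = ⁅⁅y, x⁆, ⁅x, z⁆⁆ := by rw [h1, h3]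
    _ = _ := h4

/-- `g 0, g 1, …` satisfy the Serre relations of a Dynkin diagram of type `A` whose nodes are
numbered consecutively. -/
structure IsTypeA (g : ℕ → L) : Prop where
  comm : ∀ m n, m + 2 ≤ n → ⁅g m, g n⁆ = 0
  serre : ∀ m, ⁅g m, ⁅g m, g (m + 1)⁆⁆ = 0
  serre' : ∀ m, ⁅g (m + 1), ⁅g (m + 1), g m⁆⁆ = 0

/-- The iterated bracket `⁅g n, ⁅g (n - 1), … ⁅g 1, g 0⁆ … ⁆⁆`. -/
def nested (g : ℕ → L) : ℕ → L
  | 0 => g 0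
  | n + 1 => ⁅g (n + 1), nested g n⁆

/-- An element commuting with all the constituents of an iterated bracket commutes with it. -/
theorem lie_nested_eq_zero {g : ℕ → L} {x : L} {n : ℕ} (h : ∀ m ≤ n, ⁅x, g m⁆ = 0) :
    ⁅x, nested g n⁆ = 0 := by
  induction n with
  | zero => exact h 0 le_rfl
  | succ n ih =>
    rw [nested, leibniz_lie, h _ le_rfl, ih fun m hm => h m (by omega), zero_lie, lie_zero,
      add_zero]

theorem IsTypeA.lie_nested_of_far {g : ℕ → L} (hg : IsTypeA g) {m n : ℕ} (h : n + 2 ≤ m) :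
    ⁅g m, nested g n⁆ = 0 :=
  lie_nested_eq_zero fun k hk => by
    rw [← lie_skew, hg.comm k m (by omega), neg_zero]

theorem IsTypeA.lie_nested_self {g : ℕ → L} (hg : IsTypeA g) (n : ℕ) :
    ⁅g n, nested g n⁆ = 0 := by
  match n with
  | 0 => exact lie_self _
  | 1 => exact hg.serre' 0
  | n + 2 =>
    have h0 : ⁅g (n + 2), nested g n⁆ = 0 := hg.lie_nested_of_far le_rfl
    rw [nested, nested, leibniz_lie (g (n + 2)) (g (n + 1)), h0, lie_zero, add_zero,
      leibniz_lie, h0, hg.serre', lie_zero, zero_lie, add_zero]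

/-- In type `A`, the root vector with support `0, …, n` is killed by every `g m` with `m ≤ n`. -/
theorem IsTypeA.lie_nested_of_le [LieAlgebra ℂ L] {g : ℕ → L} (hg : IsTypeA g) {m n : ℕ}
    (h : m ≤ n) : ⁅g m, nested g n⁆ = 0 := by
  induction n, h using Nat.le_induction with
  | base => exact hg.lie_nested_self m
  | succ n hmn ih =>
    rcases Nat.eq_or_lt_of_le hmn with rfl | hlt
    · rw [nested]
      match m with
      | 0 => rw [nested, ← lie_skew (g 1), lie_neg, hg.serre, neg_zero]
      | m + 1 =>
        rw [nested]
        exact lie_lie_lie_eq_zero_of_serre (hg.serre _) (hg.lie_nested_of_far le_rfl)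
          (hg.lie_nested_self (m + 1))
    · rw [nested, leibniz_lie, hg.comm m _ (by omega), ih, zero_lie, lie_zero, add_zero]

end Chain

/-! ### Root vectors of type `D` in a Lie algebra with Serre relations -/

section RootVectors

variable {L : Type*} [LieRing L]

/-- Adjacency of the nodes `u < v` of the Dynkin diagram of type `D`: the nodes `2, 3, 4, …` form
a path, and `1` is joined to `3`. -/
def Adj (u v : ℕ) : Prop := (2 ≤ u ∧ v = u + 1) ∨ (u = 1 ∧ v = 3)

/-- `f 1, f 2, …` satisfy the Serre relations of type `D`. -/
structure IsTypeD (f : ℕ → L) : Prop where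
  comm : ∀ u v, 1 ≤ u → u < v → ¬ Adj u v → ⁅f u, f v⁆ = 0
  serre : ∀ u v, Adj u v → ⁅f u, ⁅f u, f v⁆⁆ = 0
  serre' : ∀ u v, Adj u v → ⁅f v, ⁅f v, f u⁆⁆ = 0

/-- The root vector of `ε_j - ε_i`. -/
def minusVec (f : ℕ → L) (i j : ℕ) : L := nested (fun m => f (i + 1 + m)) (j - i - 1)

/-- The path `1, 3, 4, …` in the Dynkin diagram of type `D`. -/
def branch (f : ℕ → L) (m : ℕ) : L := if m = 0 then f 1 else f (m + 2)

/-- The root vector of `ε_j + ε_1`. -/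
def plusOneVec (f : ℕ → L) (j : ℕ) : L := nested (branch f) (j - 2)

/-- The root vector of `ε_j + ε_i` for `1 < i < j`, up to sign. -/
def plusVec (f : ℕ → L) (i j : ℕ) : L := ⁅minusVec f 1 j, plusOneVec f i⁆

theorem minusVec_base (f : ℕ → L) (i : ℕ) : minusVec f i (i + 1) = f (i + 1) := by
  simp [minusVec, nested]

theorem minusVec_succ (f : ℕ → L) {i j : ℕ} (h : i < j) :
    minusVec f i (j + 1) = ⁅f (j + 1), minusVec f i j⁆ := by
  obtain ⟨n, rfl⟩ := Nat.exists_eq_add_of_lt h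
  have h1 : i + n + 1 + 1 - i - 1 = n + 1 := by omega
  have h2 : i + n + 1 - i - 1 = n := by omega
  rw [minusVec, minusVec, h1, h2, nested]
  congr 2
  omega

theorem plusOneVec_base (f : ℕ → L) : plusOneVec f 2 = f 1 := rfl

theorem plusOneVec_succ (f : ℕ → L) {j : ℕ} (h : 2 ≤ j) :
    plusOneVec f (j + 1) = ⁅f (j + 1), plusOneVec f j⁆ := by
  obtain ⟨n, rfl⟩ := Nat.exists_eq_add_of_le' h
  rfl

theorem plusVec_two (f : ℕ → L) (j : ℕ) : plusVec f 2 j = -⁅f 1, minusVec f 1 j⁆ := by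
  rw [plusVec, plusOneVec_base, lie_skew]

namespace IsTypeD

variable {f : ℕ → L} (hf : IsTypeD f)
include hf

theorem comm' {u v : ℕ} (hu : 1 ≤ u) (hv : 1 ≤ v) (h1 : ¬ Adj u v) (h2 : ¬ Adj v u) :
    ⁅f u, f v⁆ = 0 := by
  rcases lt_trichotomy u v with h | rfl | h
  · exact hf.comm u v hu h h1
  · exact lie_self _
  · rw [← lie_skew, hf.comm v u hv h h2, neg_zero]

theorem isTypeA_shift {i : ℕ} (hi : 1 ≤ i) : IsTypeA fun m => f (i + 1 + m) where
  comm m n h := hf.comm _ _ (by omega) (by omega) (by unfold Adj; omega)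
  serre m := hf.serre _ _ (by unfold Adj; omega)
  serre' m := hf.serre' _ _ (by unfold Adj; omega)

theorem isTypeA_branch : IsTypeA (branch f) where
  comm m n h := by
    unfold branch
    rw [if_neg (by omega : n ≠ 0)]
    split_ifs
    · exact hf.comm _ _ (by omega) (by omega) (by unfold Adj; omega)
    · exact hf.comm _ _ (by omega) (by omega) (by unfold Adj; omega)
  serre m := by
    unfold branch
    rw [if_neg (by omega : m + 1 ≠ 0)]
    split_ifs
    · exact hf.serre _ _ (by unfold Adj; omega)
    · exact hf.serre _ _ (by unfold Adj; omega)
  serre' m := by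
    unfold branch
    rw [if_neg (by omega : m + 1 ≠ 0)]
    split_ifs
    · exact hf.serre' _ _ (by unfold Adj; omega)
    · exact hf.serre' _ _ (by unfold Adj; omega)

theorem lie_minusVec_of_mem [LieAlgebra ℂ L] {u i j : ℕ} (hi : 1 ≤ i) (h1 : i < u) (h2 : u ≤ j) :
    ⁅f u, minusVec f i j⁆ = 0 := by
  have := (hf.isTypeA_shift hi).lie_nested_of_le (m := u - i - 1) (n := j - i - 1) (by omega)
  rwa [show i + 1 + (u - i - 1) = u by omega] at this

theorem lie_minusVec_of_far {u i j : ℕ} (hu : 1 ≤ u) (hi : 1 ≤ i) (hij : i < j)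
    (h : ∀ v, i < v → v ≤ j → ¬ Adj u v ∧ ¬ Adj v u) : ⁅f u, minusVec f i j⁆ = 0 :=
  lie_nested_eq_zero fun m hm =>
    hf.comm' hu (by omega) (h _ (by omega) (by omega)).1 (h _ (by omega) (by omega)).2

theorem lie_minusVec_left {i j : ℕ} (hi : 2 ≤ i) (hij : i < j) :
    ⁅f i, minusVec f i j⁆ = -minusVec f (i - 1) j := by
  obtain ⟨i, rfl⟩ := Nat.exists_eq_add_of_le' hi
  induction j, hij using Nat.le_induction with
  | base =>
    rw [Nat.succ_eq_add_one, minusVec_base, minusVec_succ _ (by omega)]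
    rw [show i + 2 - 1 = i + 1 by omega, minusVec_base, lie_skew]
  | succ j hj ih =>
    rw [minusVec_succ _ (by omega), minusVec_succ _ (by omega), leibniz_lie, ih,
      hf.comm _ _ (by omega) (by omega) (by unfold Adj; omega), zero_lie, zero_add, lie_neg]

theorem lie_one_minusVec_two {j : ℕ} (hj : 3 ≤ j) :
    ⁅f 1, minusVec f 2 j⁆ = -plusOneVec f j := by
  induction j, hj using Nat.le_induction with
  | base => rw [minusVec_base, plusOneVec_succ _ le_rfl, plusOneVec_base, lie_skew]
  | succ j hj ih =>
    rw [minusVec_succ _ (by omega), plusOneVec_succ _ (by omega), leibniz_lie, ih,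
      hf.comm _ _ (by omega) (by omega) (by unfold Adj; omega), zero_lie, zero_add, lie_neg]

theorem lie_plusOneVec_eq_zero [LieAlgebra ℂ L] {u j : ℕ} (hu : 1 ≤ u) (hj : 2 ≤ j)
    (h2 : u = 2 → j = 2) (h3 : u ≠ j + 1) : ⁅f u, plusOneVec f j⁆ = 0 := by
  have hA := hf.isTypeA_branch
  rcases eq_or_ne u 1 with rfl | h1
  · exact hA.lie_nested_of_le (m := 0) (Nat.zero_le _)
  rcases eq_or_ne u 2 with rfl | h2'
  · rw [h2 rfl, plusOneVec_base]
    exact hf.comm' (by omega) (by omega) (by unfold Adj; omega) (by unfold Adj; omega)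
  have hb : branch f (u - 2) = f u := by
    rw [branch, if_neg (by omega), show u - 2 + 2 = u by omega]
  rw [← hb]
  rcases le_or_gt u j with h | h
  · exact hA.lie_nested_of_le (by omega)
  · exact hA.lie_nested_of_far (by omega)

/-- The two ways to reach the root `ε_j + ε_2`, from `ε_j + ε_1` and from `ε_j - ε_1`. -/
theorem lie_two_plusOneVec {j : ℕ} (hj : 3 ≤ j) :
    ⁅f 2, plusOneVec f j⁆ = ⁅f 1, minusVec f 1 j⁆ := by
  induction j, hj using Nat.le_induction with
  | base =>
    have h21 : ⁅f 2, f 1⁆ = 0 :=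
      hf.comm' (by omega) (by omega) (by unfold Adj; omega) (by unfold Adj; omega)
    have h : ⁅f 2, ⁅f 3, f 1⁆⁆ = ⁅f 1, ⁅f 3, f 2⁆⁆ := by
      rw [leibniz_lie, h21, lie_zero, add_zero, ← lie_skew (f 1), ← lie_skew (f 3) (f 2), neg_lie,
        neg_neg]
    rw [plusOneVec_succ _ le_rfl, plusOneVec_base, minusVec_succ _ (by omega), minusVec_base]
    exact h
  | succ j hj ih =>
    rw [minusVec_succ _ (by omega), plusOneVec_succ _ (by omega), leibniz_lie, ih,
      leibniz_lie (f 1), hf.comm 2 _ (by omega) (by omega) (by unfold Adj; omega),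
      hf.comm 1 _ (by omega) (by omega) (by unfold Adj; omega), zero_lie, zero_lie]

theorem lie_plusVec_right [LieAlgebra ℂ L] {i j : ℕ} (hi : 2 ≤ i) (hij : i < j) :
    ⁅f (j + 1), plusVec f i j⁆ = plusVec f i (j + 1) := by
  rw [plusVec, leibniz_lie, hf.lie_plusOneVec_eq_zero (by omega) hi (by omega) (by omega),
    lie_zero, add_zero, plusVec, minusVec_succ _ (by omega)]

theorem lie_plusVec_left [LieAlgebra ℂ L] {i j : ℕ} (hi : 2 ≤ i) (hij : i < j) :
    ⁅f (i + 1), plusVec f i j⁆ = plusVec f (i + 1) j := by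
  rw [plusVec, leibniz_lie, hf.lie_minusVec_of_mem le_rfl (by omega) (by omega), zero_lie,
    zero_add, plusVec, plusOneVec_succ _ hi]

/-- `2 ε_j` is not a root. -/
theorem plusVec_self [LieAlgebra ℂ L] {j : ℕ} (hj : 2 ≤ j) : plusVec f j j = 0 := by
  induction j, hj using Nat.le_induction with
  | base =>
    rw [plusVec, plusOneVec_base, minusVec_base]
    exact hf.comm' (by omega) (by omega) (by unfold Adj; omega) (by unfold Adj; omega)
  | succ j hj ih =>
    set a := minusVec f 1 j
    set c := plusOneVec f j
    set x := f (j + 1)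
    have ha : minusVec f 1 (j + 1) = ⁅x, a⁆ := minusVec_succ _ (by omega)
    have hc : plusOneVec f (j + 1) = ⁅x, c⁆ := plusOneVec_succ _ hj
    have hxa : ⁅x, ⁅x, a⁆⁆ = 0 := by
      rw [← ha]; exact hf.lie_minusVec_of_mem le_rfl (by omega) le_rfl
    have hxc : ⁅x, ⁅x, c⁆⁆ = 0 := by
      rw [← hc]; exact hf.lie_plusOneVec_eq_zero (by omega) (by omega) (by omega) (by omega)
    have hac : ⁅a, c⁆ = 0 := ih
    -- Both halves of `⁅x, ⁅x, ⁅a, c⁆⁆⁆ = 0` are equal to `⁅⁅x, a⁆, ⁅x, c⁆⁆`.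
    have h1 : ⁅x, ⁅⁅x, a⁆, c⁆⁆ = ⁅⁅x, a⁆, ⁅x, c⁆⁆ := by
      rw [leibniz_lie, hxa, zero_lie, zero_add]
    have h2 : ⁅x, ⁅a, ⁅x, c⁆⁆⁆ = ⁅⁅x, a⁆, ⁅x, c⁆⁆ := by
      rw [leibniz_lie, hxc, lie_zero, add_zero]
    have h3 : ⁅⁅x, a⁆, c⁆ + ⁅a, ⁅x, c⁆⁆ = 0 := by
      rw [← leibniz_lie, hac, lie_zero]
    rw [plusVec, ha, hc]
    apply eq_zero_of_eq_neg
    nth_rewrite 1 [← h1]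
    rw [← h2, eq_neg_of_add_eq_zero_left h3, lie_neg]

/-- The cases of `⁅f u, plusVec f i j⁆` in which `α_u + ε_j + ε_i` is not a root. -/
theorem lie_plusVec_eq_zero [LieAlgebra ℂ L] {u i j : ℕ} (hu : 1 ≤ u) (hi : 2 ≤ i) (hij : i < j)
    (h1 : u ≠ i + 1) (h2 : u ≠ j + 1) : ⁅f u, plusVec f i j⁆ = 0 := by
  rcases le_or_gt 3 u with h3 | h3
  · have hm : ⁅f u, minusVec f 1 j⁆ = 0 := by
      rcases le_or_gt u j with h | h
      · exact hf.lie_minusVec_of_mem le_rfl (by omega) h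
      · exact hf.lie_minusVec_of_far hu le_rfl (by omega) fun v _ _ => by unfold Adj; omega
    rw [plusVec, leibniz_lie, hm, hf.lie_plusOneVec_eq_zero hu hi (by omega) h1, zero_lie,
      lie_zero, add_zero]
  -- For `u ≤ 2`, write the root vector as `⁅f i, ⁅…, ⁅f 3, ⁅f u, y⁆⁆⁆⁆` up to sign.
  have key : ∀ y, ⁅f u, ⁅f u, y⁆⁆ = 0 → (4 ≤ j → ⁅f 3, y⁆ = 0) → plusVec f 2 j = -⁅f u, y⁆ →
      ⁅f u, plusVec f i j⁆ = 0 := by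
    intro y h0 h3y hy
    clear h1
    induction i, hi using Nat.le_induction with
    | base => rw [hy, lie_neg, h0, neg_zero]
    | succ i hi ih =>
      rw [← hf.lie_plusVec_left hi (by omega)]
      rcases Nat.eq_or_lt_of_le hi with rfl | hi3
      · rw [hy, lie_neg, lie_neg, lie_lie_lie_eq_zero_of_serre _ (h3y (by omega)) h0, neg_zero]
        exact hf.serre _ _ (by unfold Adj; omega)
      · rw [leibniz_lie, ih (by omega), hf.comm _ _ (by omega) (by omega) (by unfold Adj; omega),
          zero_lie, lie_zero, add_zero]
  have h12 : ⁅f 1, f 2⁆ = 0 := hf.comm _ _ (by omega) (by omega) (by unfold Adj; omega)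
  obtain rfl | rfl : u = 1 ∨ u = 2 := by omega
  · refine key (minusVec f 1 j) ?_ (fun h => ?_) (plusVec_two f j)
    · rw [← lie_two_plusOneVec hf (by omega), leibniz_lie,
        hf.lie_plusOneVec_eq_zero (u := 1) (by omega) (by omega) (by omega) (by omega), h12,
        zero_lie, lie_zero, add_zero]
    · exact hf.lie_minusVec_of_mem le_rfl (by omega) (by omega)
  · refine key (plusOneVec f j) ?_ (fun h => ?_) ?_
    · rw [lie_two_plusOneVec hf (by omega), leibniz_lie,
        hf.lie_minusVec_of_mem (u := 2) le_rfl (by omega) (by omega), ← lie_skew (f 2) (f 1), h12,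
        neg_zero, zero_lie, lie_zero, add_zero]
    · exact hf.lie_plusOneVec_eq_zero (by omega) (by omega) (by omega) (by omega)
    · rw [lie_two_plusOneVec hf (by omega), plusVec_two]

end IsTypeD

end RootVectors

/-! ### The Serre relations in the nilpotent Lie algebra -/

section Serre

variable {r : ℕ}

theorem cartan_of_lt {u v : Idx r} (h : (u : ℕ) < v) [Decidable (Adj u v)] :
    cartan r u v = if Adj u v then -1 else 0 := by
  obtain ⟨u, hu⟩ := u
  obtain ⟨v, hv⟩ := v
  rw [Finset.mem_Icc] at hu hv
  simp only at h
  have hcoord : ∀ a, (∑ b ∈ Finset.Icc 1 r, simpleRoot u b * (Pi.single a 1 : ℕ → ℤ) b)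
      = if a ∈ Finset.Icc 1 r then simpleRoot u a else 0 := by
    intro a
    simp [Pi.single_apply]
  have hv1 : v ≠ 1 := by omega
  simp only [cartan, Matrix.of_apply]
  rw [simpleRoot.eq_1 v, if_neg hv1]
  simp only [Pi.sub_apply, mul_sub, Finset.sum_sub_distrib, hcoord]
  rw [if_pos (Finset.mem_Icc.mpr ⟨by omega, by omega⟩),
    if_pos (Finset.mem_Icc.mpr ⟨by omega, by omega⟩)]
  simp only [simpleRoot, Adj]
  split_ifs <;> simp [Pi.single_apply] <;> (try split_ifs) <;> omega

theorem cartan_comm (u v : Idx r) : cartan r u v = cartan r v u := by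
  simp only [cartan, Matrix.of_apply, mul_comm]

theorem mk_serre (u v : Idx r) :
    (LieSubmodule.Quotient.mk (serre r u v) : Nil r) = 0 :=
  LieSubmodule.Quotient.mk_eq_zero'.mpr (LieSubmodule.subset_lieSpan ⟨(u, v), rfl⟩)

theorem gen_val (u : Idx r) :
    gen r u = LieSubmodule.Quotient.mk (FreeLieAlgebra.of ℂ u) := by
  rw [gen, dif_pos u.2]

theorem gen_of_notMem {u : ℕ} (h : u ∉ Finset.Icc 1 r) : gen r u = 0 := dif_neg h

theorem lie_gen_of_cartan_zero {u v : Idx r} (h : cartan r u v = 0) :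
    ⁅gen r u, gen r v⁆ = 0 := by
  have := mk_serre u v
  rw [serre, h] at this
  rw [gen_val, gen_val, ← LieSubmodule.Quotient.mk_bracket]
  simpa using this

theorem lie_gen_of_cartan_neg_one {u v : Idx r} (h : cartan r u v = -1) :
    ⁅gen r u, ⁅gen r u, gen r v⁆⁆ = 0 := by
  have := mk_serre u v
  rw [serre, h] at this
  rw [gen_val, gen_val, ← LieSubmodule.Quotient.mk_bracket, ← LieSubmodule.Quotient.mk_bracket]
  simpa using this

theorem isTypeD_gen (r : ℕ) : IsTypeD (gen r) := by
  classical
  refine ⟨fun u v hu huv h => ?_, fun u v h => ?_, fun u v h => ?_⟩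
  all_goals
    by_cases hur : u ∈ Finset.Icc 1 r
    swap
    · simp [gen_of_notMem hur]
    by_cases hvr : v ∈ Finset.Icc 1 r
    swap
    · simp [gen_of_notMem hvr]
  · exact lie_gen_of_cartan_zero (u := ⟨u, hur⟩) (v := ⟨v, hvr⟩)
      ((cartan_of_lt huv).trans (if_neg h))
  · have huv : u < v := by unfold Adj at h; omega
    exact lie_gen_of_cartan_neg_one (u := ⟨u, hur⟩) (v := ⟨v, hvr⟩)
      ((cartan_of_lt huv).trans (if_pos h))
  · have huv : u < v := by unfold Adj at h; omega
    exact lie_gen_of_cartan_neg_one (u := ⟨v, hvr⟩) (v := ⟨u, hur⟩)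
      ((cartan_comm _ _).trans ((cartan_of_lt huv).trans (if_pos h)))

end Serre

/-! ### Root vectors in the nilpotent Lie algebra -/

section Vec

variable {r : ℕ}

theorem iterBracket_cons {u : ℕ} {l : List ℕ} (h : l ≠ []) :
    iterBracket r (u :: l) = ⁅gen r u, iterBracket r l⁆ := by
  obtain ⟨v, l, rfl⟩ := List.exists_cons_of_ne_nil h
  rfl

theorem iterBracket_Ico_reverse {i j : ℕ} (h : i < j) :
    iterBracket r (List.Ico (i + 1) (j + 1)).reverse = minusVec (gen r) i j := by
  induction j, h using Nat.le_induction with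
  | base => simp [minusVec_base, iterBracket]
  | succ j h ih =>
    rw [List.Ico.succ_top (by omega), List.reverse_append, List.reverse_singleton,
      List.singleton_append, iterBracket_cons, ih, minusVec_succ _ h]
    simp only [ne_eq, List.reverse_eq_nil_iff, List.Ico.eq_empty_iff]
    omega

theorem iterBracket_branch {j : ℕ} (h : 2 ≤ j) :
    iterBracket r ((List.Ico 3 (j + 1)).reverse ++ [1]) = plusOneVec (gen r) j := by
  induction j, h using Nat.le_induction with
  | base => simp [plusOneVec_base, iterBracket]
  | succ j h ih =>
    rw [List.Ico.succ_top (by omega), List.reverse_append, List.reverse_singleton,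
      List.singleton_append, List.cons_append, iterBracket_cons, ih, plusOneVec_succ _ h]
    simp

/-- The last generator can be moved to the outside of an iterated bracket when it commutes with all
but its neighbour. -/
theorem iterBracket_append_pair {l : List ℕ} {v w : ℕ}
    (h : ∀ u ∈ l, ⁅gen r u, gen r v⁆ = 0) :
    iterBracket r (l ++ [w, v]) = ⁅iterBracket r (l ++ [w]), gen r v⁆ := by
  induction l with
  | nil => rfl
  | cons u l ih =>
    rw [List.cons_append, iterBracket_cons (by simp),
      ih fun x hx => h x (List.mem_cons_of_mem _ hx),
      List.cons_append, iterBracket_cons (by simp), leibniz_lie,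
      h u List.mem_cons_self, lie_zero, add_zero]

theorem iterBracket_one_cons_Ico {i : ℕ} (h : 2 ≤ i) :
    iterBracket r (1 :: List.Ico 3 (i + 1)) = (-1 : ℂ) ^ i • plusOneVec (gen r) i := by
  induction i, h using Nat.le_induction with
  | base => simp [plusOneVec_base, iterBracket]
  | succ i h ih =>
    have hlast : iterBracket r (1 :: List.Ico 3 (i + 1 + 1)) =
        ⁅iterBracket r (1 :: List.Ico 3 (i + 1)), gen r (i + 1)⁆ := by
      rcases Nat.eq_or_lt_of_le h with rfl | h3
      · rfl
      · rw [List.Ico.succ_top (by omega : 3 ≤ i + 1), List.Ico.succ_top (by omega : 3 ≤ i),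
          List.append_assoc, List.singleton_append, ← List.cons_append, ← List.cons_append]
        refine iterBracket_append_pair fun u hu => ?_
        rw [List.mem_cons, List.Ico.mem] at hu
        exact (isTypeD_gen r).comm _ _ (by omega) (by omega) (by unfold Adj; omega)
    rw [hlast, ih, plusOneVec_succ _ h, smul_lie, ← lie_skew (plusOneVec _ i), pow_succ,
      mul_neg_one, neg_smul, smul_neg]

theorem vec_minus {i j : ℕ} (h1 : 1 ≤ i) (h2 : i < j) (h3 : j ≤ r) :
    PosRoot.vec ⟨false, i, j, h1, h2, h3⟩ = minusVec (gen r) i j := by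
  simp [PosRoot.vec, iterBracket_Ico_reverse h2]

theorem vec_plus_one {j : ℕ} (h1 : 1 ≤ 1) (h2 : 1 < j) (h3 : j ≤ r) :
    PosRoot.vec ⟨true, 1, j, h1, h2, h3⟩ = plusOneVec (gen r) j := by
  simp [PosRoot.vec, iterBracket_branch (r := r) h2]

theorem vec_plus {i j : ℕ} (h1 : 1 ≤ i) (hi : 2 ≤ i) (h2 : i < j) (h3 : j ≤ r) :
    PosRoot.vec ⟨true, i, j, h1, h2, h3⟩ = (-1 : ℂ) ^ i • plusVec (gen r) i j := by
  have : i ≠ 1 := by omega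
  have h := iterBracket_Ico_reverse (r := r) (by omega : 1 < j)
  simp [PosRoot.vec, this, h, iterBracket_one_cons_Ico hi, plusVec]

end Vec

/-! ### The nilpotent Lie algebra is graded and spanned by the root vectors -/

noncomputable section RootSpan

variable {r : ℕ}

/-- The span of the root vectors of content `k`. -/
def rootSpan (r : ℕ) (k : Idx r → ℕ) : Submodule ℂ (Nil r) :=
  Submodule.span ℂ (PosRoot.vec '' {β | β.content = k})

theorem vec_mem_rootSpan {β : PosRoot r} {k : Idx r → ℕ} (h : β.content = k) :
    β.vec ∈ rootSpan r k :=
  Submodule.subset_span ⟨β, h, rfl⟩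

theorem minusVec_mem {i j : ℕ} {k : Idx r → ℕ} (h1 : 1 ≤ i) (h2 : i < j) (h3 : j ≤ r)
    (hk : PosRoot.content ⟨false, i, j, h1, h2, h3⟩ = k) : minusVec (gen r) i j ∈ rootSpan r k :=
  vec_minus h1 h2 h3 ▸ vec_mem_rootSpan hk

theorem plusOneVec_mem {j : ℕ} {k : Idx r → ℕ} (h2 : 1 < j) (h3 : j ≤ r)
    (hk : PosRoot.content ⟨true, 1, j, le_rfl, h2, h3⟩ = k) : plusOneVec (gen r) j ∈ rootSpan r k :=
  vec_plus_one le_rfl h2 h3 ▸ vec_mem_rootSpan hk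

theorem plusVec_mem {i j : ℕ} {k : Idx r → ℕ} (h1 : 2 ≤ i) (h2 : i < j) (h3 : j ≤ r)
    (hk : PosRoot.content ⟨true, i, j, one_le_two.trans h1, h2, h3⟩ = k) :
    plusVec (gen r) i j ∈ rootSpan r k := by
  have h := vec_mem_rootSpan hk
  rw [vec_plus _ h1] at h
  have h' := (rootSpan r k).smul_mem ((-1 : ℂ) ^ i) h
  rwa [smul_smul, ← mul_pow, neg_one_mul, neg_neg, one_pow, one_smul] at h'

/-- The content of the simple root `α_u`. -/
def unitContent (r u : ℕ) (w : Idx r) : ℕ := if (w : ℕ) = u then 1 else 0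

theorem content_eq {β : PosRoot r} {k : Idx r → ℕ}
    (h : ∀ w, 1 ≤ w → (hw : w ∈ Finset.Icc 1 r) → β.content ⟨w, hw⟩ = k ⟨w, hw⟩) :
    β.content = k :=
  funext fun w => h w (Finset.mem_Icc.mp w.2).1 w.2

theorem lie_gen_minusVec_mem {u i j : ℕ} (hu1 : 1 ≤ u) (hur : u ≤ r) (h1 : 1 ≤ i) (h2 : i < j)
    (h3 : j ≤ r) : ⁅gen r u, minusVec (gen r) i j⁆ ∈
      rootSpan r (PosRoot.content ⟨false, i, j, h1, h2, h3⟩ + unitContent r u) := by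
  have hf := isTypeD_gen r
  by_cases hu : u = j + 1
  · subst hu
    rw [← minusVec_succ _ h2]
    refine minusVec_mem h1 (by omega) hur (content_eq fun w _ _ => ?_)
    simp only [PosRoot.content, Pi.add_apply, unitContent]
    split_ifs <;> omega
  by_cases hu2 : 2 ≤ i ∧ u = i
  · obtain ⟨hi2, rfl⟩ := hu2
    rw [hf.lie_minusVec_left hi2 h2, neg_mem_iff]
    refine minusVec_mem (by omega) (by omega) h3 (content_eq fun w _ _ => ?_)
    simp only [PosRoot.content, Pi.add_apply, unitContent]
    split_ifs <;> omega
  by_cases hu3 : u = 1 ∧ i = 1 ∧ 3 ≤ j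
  · obtain ⟨rfl, rfl, hj⟩ := hu3
    rw [← neg_mem_iff, ← plusVec_two]
    refine plusVec_mem le_rfl (by omega) h3 (content_eq fun w _ _ => ?_)
    simp only [PosRoot.content, Pi.add_apply, unitContent]
    split_ifs <;> first | contradiction | omega
  by_cases hu4 : u = 1 ∧ i = 2
  · obtain ⟨rfl, rfl⟩ := hu4
    rw [hf.lie_one_minusVec_two h2, neg_mem_iff]
    refine plusOneVec_mem (by omega) h3 (content_eq fun w _ _ => ?_)
    simp only [PosRoot.content, Pi.add_apply, unitContent]
    split_ifs <;> first | contradiction | omega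
  have h0 : ⁅gen r u, minusVec (gen r) i j⁆ = 0 := by
    by_cases h : i < u ∧ u ≤ j
    · exact hf.lie_minusVec_of_mem h1 h.1 h.2
    · refine hf.lie_minusVec_of_far hu1 h1 h2 fun v hv1 hv2 => ?_
      unfold Adj
      omega
  rw [h0]
  exact zero_mem _

theorem lie_gen_plusOneVec_mem {u j : ℕ} (hu1 : 1 ≤ u) (hur : u ≤ r) (h2 : 1 < j)
    (h3 : j ≤ r) : ⁅gen r u, plusOneVec (gen r) j⁆ ∈
      rootSpan r (PosRoot.content ⟨true, 1, j, le_rfl, h2, h3⟩ + unitContent r u) := by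
  have hf := isTypeD_gen r
  by_cases hu : u = j + 1
  · subst hu
    rw [← plusOneVec_succ _ h2]
    refine plusOneVec_mem (by omega) hur (content_eq fun w _ _ => ?_)
    simp only [PosRoot.content, Pi.add_apply, unitContent]
    split_ifs <;> first | contradiction | omega
  by_cases hu2 : u = 2 ∧ 3 ≤ j
  · obtain ⟨rfl, hj⟩ := hu2
    rw [hf.lie_two_plusOneVec hj, ← neg_mem_iff, ← plusVec_two]
    refine plusVec_mem le_rfl (by omega) h3 (content_eq fun w _ _ => ?_)
    simp only [PosRoot.content, Pi.add_apply, unitContent]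
    split_ifs <;> first | contradiction | omega
  rw [hf.lie_plusOneVec_eq_zero hu1 h2 (by omega) hu]
  exact zero_mem _

theorem lie_gen_plusVec_mem {u i j : ℕ} (hu1 : 1 ≤ u) (hur : u ≤ r) (h1 : 2 ≤ i) (h2 : i < j)
    (h3 : j ≤ r) : ⁅gen r u, plusVec (gen r) i j⁆ ∈
      rootSpan r (PosRoot.content ⟨true, i, j, one_le_two.trans h1, h2, h3⟩ +
        unitContent r u) := by
  have hf := isTypeD_gen r
  by_cases hu : u = j + 1
  · subst hu
    rw [hf.lie_plusVec_right h1 h2]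
    refine plusVec_mem h1 (by omega) hur (content_eq fun w _ _ => ?_)
    simp only [PosRoot.content, Pi.add_apply, unitContent]
    split_ifs <;> first | contradiction | omega
  by_cases hu2 : u = i + 1
  · subst hu2
    rw [hf.lie_plusVec_left h1 h2]
    rcases Nat.eq_or_lt_of_le (Nat.succ_le_of_lt h2) with h | h
    · have h0 : plusVec (gen r) (i + 1) j = 0 := h ▸ hf.plusVec_self (by omega)
      rw [h0]
      exact zero_mem _
    refine plusVec_mem (by omega) h h3 (content_eq fun w _ _ => ?_)
    simp only [PosRoot.content, Pi.add_apply, unitContent]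
    split_ifs <;> first | contradiction | omega
  rw [hf.lie_plusVec_eq_zero hu1 h1 h2 hu2 hu]
  exact zero_mem _

/-- Bracketing with `x` maps root vectors into the span of the root vectors whose content is larger
by `k`. -/
def IsHomogeneous (k : Idx r → ℕ) (x : Nil r) : Prop :=
  ∀ l, ∀ y ∈ rootSpan r l, ⁅x, y⁆ ∈ rootSpan r (l + k)

theorem IsHomogeneous.lie {k l : Idx r → ℕ} {x y : Nil r} (hx : IsHomogeneous k x)
    (hy : IsHomogeneous l y) : IsHomogeneous (k + l) ⁅x, y⁆ := by
  intro m z hz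
  rw [lie_lie]
  refine sub_mem ?_ ?_
  · simpa only [add_assoc, add_comm l k] using hx _ _ (hy _ _ hz)
  · simpa only [add_assoc] using hy _ _ (hx _ _ hz)

theorem isHomogeneous_gen {u : ℕ} (hu1 : 1 ≤ u) (hur : u ≤ r) :
    IsHomogeneous (unitContent r u) (gen r u) := by
  intro l y hy
  induction hy using Submodule.span_induction with
  | mem y hy =>
    obtain ⟨⟨s, i, j, h1, h2, h3⟩, rfl, rfl⟩ := hy
    cases s
    · rw [vec_minus]
      exact lie_gen_minusVec_mem hu1 hur h1 h2 h3
    · rcases Nat.eq_or_lt_of_le h1 with rfl | hi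
      · rw [vec_plus_one]
        exact lie_gen_plusOneVec_mem hu1 hur h2 h3
      · rw [vec_plus _ hi, lie_smul]
        exact Submodule.smul_mem _ _ (lie_gen_plusVec_mem hu1 hur hi h2 h3)
  | zero => rw [lie_zero]; exact zero_mem _
  | add y z _ _ hy hz => rw [lie_add]; exact add_mem hy hz
  | smul c y _ hy => rw [lie_smul]; exact Submodule.smul_mem _ _ hy

theorem isHomogeneous_minusVec {i j : ℕ} (h1 : 1 ≤ i) (h2 : i < j) (h3 : j ≤ r) :
    IsHomogeneous (PosRoot.content ⟨false, i, j, h1, h2, h3⟩) (minusVec (gen r) i j) := by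
  induction j, h2 using Nat.le_induction with
  | base =>
    convert isHomogeneous_gen (r := r) (u := i + 1) (by omega) h3 using 1
    swap
    · exact minusVec_base _ _
    refine content_eq fun w _ _ => ?_
    simp only [PosRoot.content, unitContent]
    split_ifs <;> omega
  | succ j h2 ih =>
    rw [minusVec_succ _ h2]
    convert (isHomogeneous_gen (by omega) h3).lie (ih (by omega)) using 1
    refine content_eq fun w _ _ => ?_
    simp only [PosRoot.content, unitContent, Pi.add_apply]
    split_ifs <;> omega

theorem isHomogeneous_plusOneVec {j : ℕ} (h2 : 1 < j) (h3 : j ≤ r) :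
    IsHomogeneous (PosRoot.content ⟨true, 1, j, le_rfl, h2, h3⟩) (plusOneVec (gen r) j) := by
  induction j, h2 using Nat.le_induction with
  | base =>
    convert isHomogeneous_gen (r := r) (u := 1) le_rfl (by omega) using 1
    swap
    · exact plusOneVec_base _
    refine content_eq fun w _ _ => ?_
    simp only [PosRoot.content, unitContent]
    split_ifs <;> first | contradiction | omega
  | succ j h2 ih =>
    rw [plusOneVec_succ _ h2]
    convert (isHomogeneous_gen (by omega) h3).lie (ih (by omega)) using 1
    refine content_eq fun w _ _ => ?_
    simp only [PosRoot.content, unitContent, Pi.add_apply]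
    split_ifs <;> first | contradiction | omega

theorem isHomogeneous_plusVec {i j : ℕ} (h1 : 2 ≤ i) (h2 : i < j) (h3 : j ≤ r) :
    IsHomogeneous (PosRoot.content ⟨true, i, j, one_le_two.trans h1, h2, h3⟩)
      (plusVec (gen r) i j) := by
  rw [plusVec]
  convert (isHomogeneous_minusVec le_rfl (by omega) h3).lie
    (isHomogeneous_plusOneVec (r := r) h1 (by omega)) using 1
  refine content_eq fun w _ _ => ?_
  simp only [PosRoot.content, Pi.add_apply]
  split_ifs <;> first | contradiction | omega

theorem isHomogeneous_vec (β : PosRoot r) : IsHomogeneous β.content β.vec := by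
  obtain ⟨s, i, j, h1, h2, h3⟩ := β
  cases s
  · rw [vec_minus]
    exact isHomogeneous_minusVec h1 h2 h3
  · rcases Nat.eq_or_lt_of_le h1 with rfl | hi
    · rw [vec_plus_one]
      exact isHomogeneous_plusOneVec h2 h3
    · intro l y hy
      rw [vec_plus _ hi, smul_lie]
      exact Submodule.smul_mem _ _ (isHomogeneous_plusVec hi h2 h3 l y hy)

theorem lie_vec_vec_mem (β γ : PosRoot r) :
    ⁅β.vec, γ.vec⁆ ∈ rootSpan r (β.content + γ.content) := by
  rw [add_comm]
  exact isHomogeneous_vec β _ _ (vec_mem_rootSpan rfl)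

end RootSpan

/-! ### Straightening of monomials -/

section Straightening

variable {A ι M : Type*} [Ring A] [Algebra ℂ A] [AddCommMonoid M]

/-- The span of the products of fewer than `n` factors `x a` with total weight `m`. -/
def wordSpan (x : ι → A) (w : ι → M) (n : ℕ) (m : M) : Submodule ℂ A :=
  Submodule.span ℂ {y | ∃ l : List ι, l.length < n ∧ (l.map w).sum = m ∧ (l.map x).prod = y}

theorem mul_mem_wordSpan {x : ι → A} {w : ι → M} {n : ℕ} {m : M} {y : A}
    (hy : y ∈ wordSpan x w n m) (a : ι) : x a * y ∈ wordSpan x w (n + 1) (w a + m) := by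
  induction hy using Submodule.span_induction with
  | mem y hy =>
    obtain ⟨l, h1, rfl, rfl⟩ := hy
    exact Submodule.subset_span ⟨a :: l, by simpa using h1, by simp, by simp⟩
  | zero => rw [mul_zero]; exact zero_mem _
  | add y z _ _ hy hz => rw [mul_add]; exact add_mem hy hz
  | smul c y _ hy => rw [mul_smul_comm]; exact Submodule.smul_mem _ _ hy

/-- When commutators of the `x a` are combinations of the `x c`, a permutation of the factors
changes a product only by shorter products. -/
theorem prod_sub_prod_mem_of_perm {x : ι → A} {w : ι → M}
    (hx : ∀ a b, x a * x b - x b * x a ∈ Submodule.span ℂ (x '' {c | w c = w a + w b}))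
    {l l' : List ι} (h : l.Perm l') :
    (l.map x).prod - (l'.map x).prod ∈ wordSpan x w l.length (l.map w).sum := by
  induction h with
  | nil => simp
  | cons a _ ih =>
    simpa [mul_sub] using mul_mem_wordSpan ih a
  | swap a b l =>
    have key : ∀ y ∈ Submodule.span ℂ (x '' {c | w c = w b + w a}),
        y * (l.map x).prod ∈ wordSpan x w (l.length + 2) (w b + (w a + (l.map w).sum)) := by
      intro y hy
      induction hy using Submodule.span_induction with
      | mem y hy =>
        obtain ⟨c, hc, rfl⟩ := hy
        rw [Set.mem_ofPred_eq] at hc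
        exact Submodule.subset_span ⟨c :: l, by simp, by simp [hc, add_assoc], by simp⟩
      | zero => rw [zero_mul]; exact zero_mem _
      | add y z _ _ hy hz => rw [add_mul]; exact add_mem hy hz
      | smul c y _ hy => rw [smul_mul_assoc]; exact Submodule.smul_mem _ _ hy
    simpa [sub_mul, mul_assoc] using key _ (hx b a)
  | trans h1 _ ih1 ih2 =>
    rw [← h1.length_eq, ← (h1.map w).sum_eq] at ih2
    simpa using add_mem ih1 ih2

/-- If every product can be permuted into one lying in `S` of its weight, then `S` contains all
products. -/
theorem prod_mem_of_straighten {x : ι → A} {w : ι → M}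
    (hx : ∀ a b, x a * x b - x b * x a ∈ Submodule.span ℂ (x '' {c | w c = w a + w b}))
    {S : M → Submodule ℂ A}
    (hS : ∀ l : List ι, ∃ l', l.Perm l' ∧ (l'.map x).prod ∈ S (l.map w).sum) (l : List ι) :
    (l.map x).prod ∈ S (l.map w).sum := by
  induction hn : l.length using Nat.strong_induction_on generalizing l with
  | _ n ih =>
    obtain ⟨l', hl, hl'⟩ := hS l
    have hle : wordSpan x w l.length (l.map w).sum ≤ S (l.map w).sum := by
      refine Submodule.span_le.mpr ?_
      rintro _ ⟨l₁, h1, h2, rfl⟩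
      rw [← h2]
      exact ih _ (hn ▸ h1) l₁ rfl
    have := add_mem (hle (prod_sub_prod_mem_of_perm hx hl)) hl'
    rwa [sub_add_cancel] at this

end Straightening

/-! ### Poincaré–Birkhoff–Witt monomials span -/

noncomputable section PBW

variable {r : ℕ}

/-- The image of a root vector in the enveloping algebra. -/
def rootVec (β : PosRoot r) : UNil r := UniversalEnvelopingAlgebra.ι ℂ β.vec

/-- The increasing list of roots in which `β` occurs `p β` times. -/
def sortedList (p : PosRoot r → ℕ) : List (PosRoot r) :=
  ((Finset.univ : Finset (PosRoot r)).sort (· ≤ ·)).flatMap fun β => List.replicate (p β) β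

theorem count_sortedList (p : PosRoot r → ℕ) (β : PosRoot r) : (sortedList p).count β = p β := by
  have hs : ((Finset.univ : Finset (PosRoot r)).sort (· ≤ ·)).Nodup := Finset.sort_nodup _ _
  have hβ : β ∈ (Finset.univ : Finset (PosRoot r)).sort (· ≤ ·) := by simp
  rw [sortedList, List.count_flatMap]
  have : ((Finset.univ : Finset (PosRoot r)).sort (· ≤ ·)).map
      (List.count β ∘ fun γ => List.replicate (p γ) γ) =
      ((Finset.univ : Finset (PosRoot r)).sort (· ≤ ·)).map (Pi.single β (p β)) := by
    refine List.map_congr_left fun γ _ => ?_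
    rcases eq_or_ne γ β with rfl | h
    · simp
    · simp [List.count_replicate, h]
  rw [this, ← List.sum_toFinset _ hs, Finset.sort_toFinset]
  simp

theorem pbwMonomial_eq (p : PosRoot r → ℕ) :
    pbwMonomial p = ((sortedList p).map rootVec).prod := by
  simp only [pbwMonomial, sortedList, List.map_flatMap, List.map_replicate, rootVec]
  induction (Finset.univ : Finset (PosRoot r)).sort (· ≤ ·) with
  | nil => simp
  | cons a l ih =>
    rw [List.map_cons, List.prod_cons, ih, List.flatMap_cons, List.prod_append, List.prod_replicate]

theorem pbwContent_count (l : List (PosRoot r)) :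
    pbwContent (fun β => l.count β) = (l.map PosRoot.content).sum := by
  induction l with
  | nil => ext; simp [pbwContent]
  | cons a l ih =>
    ext u
    rw [List.map_cons, List.sum_cons, ← ih]
    simp [pbwContent, List.count_cons, add_mul, Finset.sum_add_distrib, add_comm]

theorem pbwContent_eq (p : PosRoot r → ℕ) :
    pbwContent p = ((sortedList p).map PosRoot.content).sum := by
  rw [← pbwContent_count]
  simp only [count_sortedList]

attribute [local instance] LieRing.ofAssociativeRing in
theorem commutator_rootVec_mem (β γ : PosRoot r) :
    rootVec β * rootVec γ - rootVec γ * rootVec β ∈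
      Submodule.span ℂ (rootVec '' {δ | δ.content = β.content + γ.content}) := by
  rw [rootVec, rootVec, ← LieRing.of_associative_ring_bracket, ← LieHom.map_lie]
  have h := Submodule.mem_map_of_mem
    (f := (UniversalEnvelopingAlgebra.ι ℂ : Nil r →ₗ⁅ℂ⁆ UNil r).toLinearMap) (lie_vec_vec_mem β γ)
  rw [rootSpan, Submodule.map_span, Set.image_image] at h
  exact h

/-- The span of the ordered monomials of content `k`. -/
def pbwSpan (r : ℕ) (k : Idx r → ℕ) : Submodule ℂ (UNil r) :=
  Submodule.span ℂ (pbwMonomial '' {p | pbwContent p = k})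

theorem prod_rootVec_mem_pbwSpan (l : List (PosRoot r)) :
    (l.map rootVec).prod ∈ pbwSpan r (l.map PosRoot.content).sum := by
  refine prod_mem_of_straighten commutator_rootVec_mem (fun l => ?_) l
  refine ⟨sortedList fun β => l.count β, ?_, ?_⟩
  · rw [List.perm_iff_count]
    intro β
    rw [count_sortedList]
  · rw [← pbwMonomial_eq, ← pbwContent_count]
    exact Submodule.subset_span ⟨_, rfl, rfl⟩

/-- The simple root `α_u` among the positive roots. -/
def simplePosRoot (hr : 2 ≤ r) (u : Idx r) : PosRoot r :=
  if h : (u : ℕ) = 1 then ⟨true, 1, 2, le_rfl, one_lt_two, hr⟩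
  else ⟨false, u - 1, u, by have := Finset.mem_Icc.mp u.2; omega,
    by have := Finset.mem_Icc.mp u.2; omega, (Finset.mem_Icc.mp u.2).2⟩

theorem vec_simplePosRoot (hr : 2 ≤ r) (u : Idx r) : (simplePosRoot hr u).vec = gen r u := by
  unfold simplePosRoot
  split_ifs with h
  · rw [vec_plus_one, plusOneVec_base, h]
  · have hu := Finset.mem_Icc.mp u.2
    rw [vec_minus]
    obtain ⟨n, hn⟩ : ∃ n, (u : ℕ) = n + 1 := ⟨u - 1, by omega⟩
    rw [hn, Nat.add_sub_cancel, minusVec_base]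

theorem content_simplePosRoot (hr : 2 ≤ r) (u : Idx r) :
    (simplePosRoot hr u).content = fun w => if u = w then 1 else 0 := by
  have hu := Finset.mem_Icc.mp u.2
  refine content_eq fun w _ hw => ?_
  simp only [Subtype.ext_iff]
  unfold simplePosRoot
  split_ifs <;> simp only [PosRoot.content] <;> split_ifs <;> first | contradiction | omega

theorem quotMap_freeMonomial {n : ℕ} (J : Fin n → Idx r) :
    quotMap r (freeMonomial J) =
      ((List.ofFn J).reverse.map fun u : Idx r =>
        UniversalEnvelopingAlgebra.ι ℂ (gen r u.1)).prod := by
  rw [freeMonomial, map_list_prod, List.map_reverse, List.map_ofFn, List.map_reverse,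
    List.map_ofFn]
  congr 3
  ext s
  simp [quotMap]

theorem quotMap_freeMonomial_mem (hr : 2 ≤ r) {k : Idx r → ℕ} {J : Fin (∑ u, k u) → Idx r}
    (hJ : J ∈ multiIndices k) : quotMap r (freeMonomial J) ∈ pbwSpan r k := by
  have h := prod_rootVec_mem_pbwSpan ((List.ofFn J).reverse.map (simplePosRoot hr))
  rw [quotMap_freeMonomial]
  have h1 : (List.ofFn J).reverse.map (fun u : Idx r => UniversalEnvelopingAlgebra.ι ℂ (gen r u)) =
      ((List.ofFn J).reverse.map (simplePosRoot hr)).map rootVec := by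
    rw [List.map_map]
    refine List.map_congr_left fun u _ => ?_
    rw [Function.comp_apply, rootVec, vec_simplePosRoot]
  have h2 : (((List.ofFn J).reverse.map (simplePosRoot hr)).map PosRoot.content).sum = k := by
    ext u
    rw [multiIndices, Finset.mem_filter] at hJ
    rw [List.map_map, List.map_reverse, List.sum_reverse, List.map_ofFn, List.sum_ofFn,
      Finset.sum_apply, ← hJ.2 u, Finset.card_filter]
    exact Finset.sum_congr rfl fun s _ => congrFun (content_simplePosRoot hr (J s)) u
  rw [h2] at h
  rwa [h1]

/-- Every canonical form has an expansion in ordered monomials. -/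
theorem exists_isPBWExpansion (hr : 2 ≤ r) (k : Idx r → ℕ) :
    ∃ ω : (PosRoot r → ℕ) →₀ RatFun r, IsPBWExpansion k ω := by
  let Φ : ((PosRoot r → ℕ) →₀ RatFun r) →ₗ[ℂ] RatFun r ⊗[ℂ] UNil r :=
    Finsupp.lsum ℂ fun p => (TensorProduct.mk ℂ (RatFun r) (UNil r)).flip (pbwMonomial p)
  suffices h : canonicalFormD k ∈ (Finsupp.supported (RatFun r) ℂ {p | pbwContent p = k}).map Φ by
    obtain ⟨ω, hω, hΦ⟩ := h
    exact ⟨ω, fun p hp => hω hp, hΦ.symm⟩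
  rw [canonicalFormD, canonicalForm, map_sum]
  refine sum_mem fun J hJ => ?_
  rw [LinearMap.lTensor_tmul]
  have hmem : quotMap r (freeMonomial J) ∈ pbwSpan r k := quotMap_freeMonomial_mem hr hJ
  change _ ⊗ₜ[ℂ] (quotMap r (freeMonomial J)) ∈ _
  generalize quotMap r (freeMonomial J) = y at hmem
  induction hmem using Submodule.span_induction with
  | mem y hy =>
    obtain ⟨p, hp, rfl⟩ := hy
    exact ⟨Finsupp.single p (sym k (chainFun J)), Finsupp.single_mem_supported _ _ hp, by simp [Φ]⟩
  | zero => rw [TensorProduct.tmul_zero]; exact zero_mem _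
  | add y z _ _ hy hz => rw [TensorProduct.tmul_add]; exact add_mem hy hz
  | smul c y _ hy => rw [TensorProduct.tmul_smul]; exact Submodule.smul_mem _ _ hy

end PBW

/-! ### The universal property of the nilpotent Lie algebra -/

noncomputable section Lift

variable {r : ℕ} {L : Type*} [LieRing L] [LieAlgebra ℂ L] {f : ℕ → L}

theorem lift_serre (hf : IsTypeD f) (u v : Idx r) :
    FreeLieAlgebra.lift ℂ (fun u : Idx r => f u) (serre r u v) = 0 := by
  classical
  have hu := Finset.mem_Icc.mp u.2
  have hv := Finset.mem_Icc.mp v.2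
  rcases lt_trichotomy (u : ℕ) v with h | h | h
  · rw [serre, cartan_of_lt h]
    split_ifs with hA
    · simpa using hf.serre _ _ hA
    · simpa using hf.comm _ _ hu.1 h hA
  · rw [serre, Subtype.ext h, lie_self, map_zero, map_zero]
  · rw [serre, cartan_comm, cartan_of_lt h]
    split_ifs with hA
    · simpa using hf.serre' _ _ hA
    · have h0 := hf.comm _ _ hv.1 h hA
      rw [← lie_skew, neg_eq_zero] at h0
      simpa using h0

/-- The homomorphism from `𝔫` given by elements that satisfy the Serre relations. -/
def nilLift (r : ℕ) (hf : IsTypeD f) : Nil r →ₗ⁅ℂ⁆ L :=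
  { Submodule.liftQ (serreIdeal r).toSubmodule
      (FreeLieAlgebra.lift ℂ (fun u : Idx r => f u) : FreeLieAlgebra ℂ (Idx r) →ₗ[ℂ] L) (by
        have h : serreIdeal r ≤ (FreeLieAlgebra.lift ℂ (fun u : Idx r => f u)).ker := by
          refine LieSubmodule.lieSpan_le.mpr ?_
          rintro _ ⟨⟨u, v⟩, rfl⟩
          exact LieHom.mem_ker.mpr (lift_serre hf u v)
        exact fun x hx => LieHom.mem_ker.mp (h hx)) with
    map_lie' := by
      intro x y
      induction x using Quotient.inductionOn'
      induction y using Quotient.inductionOn'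
      exact LieHom.map_lie (FreeLieAlgebra.lift ℂ (fun u : Idx r => f u)) _ _ }

theorem nilLift_gen (hf : IsTypeD f) {u : ℕ} (h1 : 1 ≤ u) (hr : u ≤ r) :
    nilLift r hf (gen r u) = f u := by
  rw [gen, dif_pos (Finset.mem_Icc.mpr ⟨h1, hr⟩)]
  exact FreeLieAlgebra.lift_of_apply ..

end Lift

noncomputable section EnvLift

attribute [local instance] LieRing.ofAssociativeRing

variable {A : Type*} [Ring A] {f : ℕ → A}

/-- The Serre relations for commutators, written without brackets: on `Module.End` the bracket of
the ring structure competes with the one of the action on a space of linear maps. -/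
theorem isTypeD_of_commutators
    (hcomm : ∀ u v, 1 ≤ u → u < v → ¬ Adj u v → f u * f v - f v * f u = 0)
    (hserre : ∀ u v, Adj u v →
      f u * (f v * f u - f u * f v) - (f v * f u - f u * f v) * f u = 0)
    (hserre' : ∀ u v, Adj u v →
      f v * (f v * f u - f u * f v) - (f v * f u - f u * f v) * f v = 0) : IsTypeD f where
  comm := hcomm
  serre u v h := by
    rw [← lie_skew (f u) (f v), lie_neg, neg_eq_zero]
    exact hserre u v h
  serre' := hserre'

variable [Algebra ℂ A]

/-- The homomorphism from `U(𝔫)` given by elements of an associative algebra that satisfy the Serre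
relations. -/
def envLift (r : ℕ) (hf : IsTypeD f) : UNil r →ₐ[ℂ] A :=
  UniversalEnvelopingAlgebra.lift ℂ (nilLift r hf)

theorem envLift_gen {r : ℕ} (hf : IsTypeD f) {u : ℕ} (h1 : 1 ≤ u) (hr : u ≤ r) :
    envLift r hf (UniversalEnvelopingAlgebra.ι ℂ (gen r u)) = f u :=
  (UniversalEnvelopingAlgebra.lift_ι_apply ..).trans (nilLift_gen hf h1 hr)

theorem map_ι_lie {r : ℕ} (F : UNil r →ₐ[ℂ] A) (x y : Nil r) :
    F (UniversalEnvelopingAlgebra.ι ℂ ⁅x, y⁆) =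
      F (UniversalEnvelopingAlgebra.ι ℂ x) * F (UniversalEnvelopingAlgebra.ι ℂ y) -
        F (UniversalEnvelopingAlgebra.ι ℂ y) * F (UniversalEnvelopingAlgebra.ι ℂ x) := by
  rw [LieHom.map_lie, LieRing.of_associative_ring_bracket, map_sub, map_mul, map_mul]

end EnvLift

/-! ### The vector representation -/

noncomputable section VectorRep

/-- The space of functions on `ℤ`, with the unit vectors `e_a`, `a ∈ ℤ`. The vector representation
of type `D_r` is spanned by the `e_a` with `1 ≤ |a| ≤ r`; the other coordinates play no role. -/
abbrev VecSpace : Type := ℤ → ℂ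

/-- The unit vector `e_a`. -/
abbrev basisVec (a : ℤ) : VecSpace := Pi.single a 1

/-- The matrix unit sending `e_a` to `e_b`. -/
def matUnit (b a : ℤ) : Module.End ℂ VecSpace :=
  LinearMap.single ℂ (fun _ => ℂ) b ∘ₗ LinearMap.proj a

/-- The element `E_{b,a} - E_{-a,-b}` of the orthogonal Lie algebra of the form pairing `e_a` with
`e_{-a}`. -/
def rootOp (b a : ℤ) : Module.End ℂ VecSpace := matUnit b a - matUnit (-a) (-b)

theorem matUnit_mul (b a d c : ℤ) :
    matUnit b a * matUnit d c = if a = d then matUnit b c else 0 := by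
  ext v : 1
  by_cases h : a = d
  · subst h
    simp [matUnit]
  · simp [matUnit, h]

theorem rootOp_basisVec (b a c : ℤ) :
    rootOp b a (basisVec c) =
      (if c = a then basisVec b else 0) - if c = -b then basisVec (-a) else 0 := by
  simp only [rootOp, matUnit, LinearMap.sub_apply, LinearMap.comp_apply, LinearMap.proj_apply,
    LinearMap.single_apply, Pi.single_apply, @eq_comm ℤ c]
  split_ifs <;> simp

theorem commutator_rootOp (b a d c : ℤ) :
    rootOp b a * rootOp d c - rootOp d c * rootOp b a =
      (if a = d then rootOp b c else 0) - (if c = b then rootOp d a else 0)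
        - (if a = -c then rootOp b (-d) else 0) - (if -b = d then rootOp (-a) c else 0) := by
  have h1 : (-d = -a) = (a = d) := by rw [eq_iff_iff]; omega
  have h2 : (-b = -c) = (c = b) := by rw [eq_iff_iff]; omega
  have h3 : (c = -a) = (a = -c) := by rw [eq_iff_iff]; omega
  have h4 : (-d = b) = (-b = d) := by rw [eq_iff_iff]; omega
  simp only [rootOp, mul_sub, sub_mul, matUnit_mul, neg_neg, h1, h2, h3, h4]
  split_ifs <;> abel

theorem commutator_rootOp_of_eq {b a c : ℤ} (h1 : c ≠ b) (h2 : a ≠ -c) (h3 : -b ≠ a) :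
    rootOp b a * rootOp a c - rootOp a c * rootOp b a = rootOp b c := by
  rw [commutator_rootOp, if_pos rfl, if_neg h1, if_neg h2, if_neg h3, sub_zero, sub_zero, sub_zero]

theorem commutator_rootOp_eq_zero {b a d c : ℤ} (h0 : a ≠ d) (h1 : c ≠ b) (h2 : a ≠ -c)
    (h3 : -b ≠ d) : rootOp b a * rootOp d c - rootOp d c * rootOp b a = 0 := by
  rw [commutator_rootOp, if_neg h0, if_neg h1, if_neg h2, if_neg h3, sub_zero, sub_zero, sub_zero]

/-- The operators by which the Chevalley generators act on the vector representation. -/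
def genOp (u : ℕ) : Module.End ℂ VecSpace := if u = 1 then rootOp 2 (-1) else rootOp u (u - 1)

theorem genOp_one : genOp 1 = rootOp 2 (-1) := if_pos rfl

theorem genOp_of_ne {u : ℕ} (h : u ≠ 1) : genOp u = rootOp u (u - 1) := if_neg h

theorem isTypeD_genOp : @IsTypeD _ LieRing.ofAssociativeRing genOp := by
  have h12 : rootOp 2 (-2) = 0 := sub_self _
  have h3 : genOp 3 = rootOp 3 2 := genOp_of_ne (by omega)
  refine isTypeD_of_commutators (fun u v hu huv h => ?_) (fun u v h => ?_) (fun u v h => ?_)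
  · rw [genOp_of_ne (by omega : v ≠ 1)]
    unfold Adj at h
    rcases eq_or_ne u 1 with rfl | hu1
    · rw [genOp_one]
      rcases eq_or_ne v 2 with rfl | hv2
      · rw [commutator_rootOp]
        simp [h12]
      · exact commutator_rootOp_eq_zero (by omega) (by omega) (by omega) (by omega)
    · rw [genOp_of_ne hu1]
      exact commutator_rootOp_eq_zero (by omega) (by omega) (by omega) (by omega)
  all_goals
    obtain ⟨hu, rfl⟩ | ⟨rfl, rfl⟩ := h
    · rw [genOp_of_ne (by omega), genOp_of_ne (by omega), Nat.cast_succ, add_sub_cancel_right,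
        commutator_rootOp_of_eq (by omega) (by omega) (by omega)]
      exact commutator_rootOp_eq_zero (by omega) (by omega) (by omega) (by omega)
    · rw [genOp_one, h3, commutator_rootOp_of_eq (by omega) (by omega) (by omega)]
      exact commutator_rootOp_eq_zero (by omega) (by omega) (by omega) (by omega)

/-- The action of the enveloping algebra on the vector representation. -/
def vecAct (r : ℕ) : UNil r →ₐ[ℂ] Module.End ℂ VecSpace := envLift r isTypeD_genOp

variable {r : ℕ}

theorem vecAct_ι_gen {u : ℕ} (h1 : 1 ≤ u) (hr : u ≤ r) :
    vecAct r (UniversalEnvelopingAlgebra.ι ℂ (gen r u)) = genOp u :=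
  envLift_gen _ h1 hr

theorem vecAct_ι_minusVec {i j : ℕ} (h1 : 1 ≤ i) (h2 : i < j) (h3 : j ≤ r) :
    vecAct r (UniversalEnvelopingAlgebra.ι ℂ (minusVec (gen r) i j)) = rootOp j i := by
  induction j, h2 using Nat.le_induction with
  | base =>
    rw [Nat.succ_eq_add_one, minusVec_base, vecAct_ι_gen (by omega) h3, genOp_of_ne (by omega),
      Nat.cast_succ, add_sub_cancel_right]
  | succ j h2 ih =>
    rw [minusVec_succ _ h2, map_ι_lie, ih (by omega), vecAct_ι_gen (by omega) h3,
      genOp_of_ne (by omega), Nat.cast_succ, add_sub_cancel_right,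
      commutator_rootOp_of_eq (by omega) (by omega) (by omega)]

theorem vecAct_ι_plusOneVec {j : ℕ} (h2 : 1 < j) (h3 : j ≤ r) :
    vecAct r (UniversalEnvelopingAlgebra.ι ℂ (plusOneVec (gen r) j)) = rootOp j (-1) := by
  induction j, h2 using Nat.le_induction with
  | base =>
    rw [Nat.succ_eq_add_one, plusOneVec_base, vecAct_ι_gen (by omega) (by omega), genOp_one]
    rfl
  | succ j h2 ih =>
    rw [plusOneVec_succ _ h2, map_ι_lie, ih (by omega), vecAct_ι_gen (by omega) h3,
      genOp_of_ne (by omega), Nat.cast_succ, add_sub_cancel_right,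
      commutator_rootOp_of_eq (by omega) (by omega) (by omega)]

theorem vecAct_ι_plusVec {i j : ℕ} (h1 : 2 ≤ i) (h2 : i < j) (h3 : j ≤ r) :
    vecAct r (UniversalEnvelopingAlgebra.ι ℂ (plusVec (gen r) i j)) = -rootOp j (-i) := by
  rw [plusVec, map_ι_lie, vecAct_ι_minusVec le_rfl (by omega) h3,
    vecAct_ι_plusOneVec h1 (by omega), commutator_rootOp,
    if_neg (by omega), if_neg (by omega), if_pos (by simp), if_neg (by omega)]
  simp

/-- The root vector of `β` maps `e_a` to a multiple of `e_j` for this `a`, namely `i` for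
`β = ε_j - ε_i` and `-i` for `β = ε_j + ε_i`. -/
def PosRoot.source (β : PosRoot r) : ℤ := if β.plus then -β.i else β.i

/-- The sign with which the root vector of `β` maps `e_a` to `e_j`, where `a` is the source. -/
def PosRoot.sign (β : PosRoot r) : ℂ := if β.plus then (-1) ^ (β.i + 1) else 1

theorem PosRoot.sign_mul_sign (β : PosRoot r) : β.sign * β.sign = 1 := by
  unfold PosRoot.sign
  split_ifs
  · rw [← mul_pow]
    norm_num
  · norm_num

theorem vecAct_ι_vec (β : PosRoot r) :
    vecAct r (UniversalEnvelopingAlgebra.ι ℂ β.vec) = β.sign • rootOp β.j β.source := by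
  obtain ⟨s, i, j, h1, h2, h3⟩ := β
  cases s
  · rw [vec_minus, vecAct_ι_minusVec h1 h2 h3]
    simp [PosRoot.sign, PosRoot.source]
  · rcases Nat.eq_or_lt_of_le h1 with rfl | hi
    · rw [vec_plus_one, vecAct_ι_plusOneVec h2 h3]
      simp [PosRoot.sign, PosRoot.source]
    · rw [vec_plus _ hi, map_smul, map_smul, vecAct_ι_plusVec hi h2 h3]
      simp [PosRoot.sign, PosRoot.source, pow_succ]
      exact (neg_smul _ _).symm

theorem vecAct_ι_vec_basisVec_source (β : PosRoot r) :
    vecAct r (UniversalEnvelopingAlgebra.ι ℂ β.vec) (basisVec β.source) =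
      β.sign • basisVec β.j := by
  have := β.lt
  rw [vecAct_ι_vec, LinearMap.smul_apply, rootOp_basisVec, if_pos rfl, if_neg, sub_zero]
  unfold PosRoot.source
  split_ifs <;> omega

theorem vecAct_ι_vec_basisVec_source_of_ne {β γ : PosRoot r} (hj : γ.j = β.j) (h : γ ≠ β) :
    vecAct r (UniversalEnvelopingAlgebra.ι ℂ γ.vec) (basisVec β.source) = 0 := by
  have := β.lt
  have := β.one_le
  have := γ.one_le
  rw [vecAct_ι_vec, LinearMap.smul_apply, rootOp_basisVec, if_neg, if_neg, sub_zero, smul_zero]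
  · unfold PosRoot.source
    split_ifs <;> omega
  · intro hs
    apply h
    unfold PosRoot.source at hs
    obtain ⟨s, i, j, h1, h2, h3⟩ := β
    obtain ⟨s', i', j', h1', h2', h3'⟩ := γ
    cases s <;> cases s' <;> simp at hs hj ⊢ <;> omega

/-! ### The matrix coefficient attached to a root -/

/-- The matrix coefficient `x ↦ ⟨e_j^*, x e_a⟩` of the vector representation, where `a` is the
source of `β`. -/
def matCoeff (β : PosRoot r) : UNil r →ₗ[ℂ] ℂ :=
  LinearMap.proj (β.j : ℤ) ∘ₗ LinearMap.applyₗ (basisVec β.source) ∘ₗ (vecAct r).toLinearMap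

theorem matCoeff_apply (β : PosRoot r) (x : UNil r) :
    matCoeff β x = vecAct r x (basisVec β.source) β.j := rfl

theorem sortedList_pairwise (p : PosRoot r → ℕ) : (sortedList p).Pairwise (· ≤ ·) := by
  rw [sortedList, List.pairwise_flatMap]
  refine ⟨fun β _ => List.pairwise_replicate.mpr (Or.inr le_rfl), ?_⟩
  refine (Finset.pairwise_sort (Finset.univ : Finset (PosRoot r)) (· ≤ ·)).imp ?_
  intro β γ h x hx y hy
  rwa [List.eq_of_mem_replicate hx, List.eq_of_mem_replicate hy]

theorem PosRoot.j_le_of_le {β γ : PosRoot r} (h : β ≤ γ) : β.j ≤ γ.j := by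
  have h' : β.key ≤ γ.key := h
  exact (Prod.Lex.monotone_fst _ _ h' :)

theorem PosRoot.le_j_of_content_pos {β : PosRoot r} {u : Idx r} (h : 0 < β.content u) :
    (u : ℕ) ≤ β.j := by
  have := β.lt
  have := β.one_le
  unfold PosRoot.content at h
  split_ifs at h <;> omega

/-- A root `ε_j ± ε_i` contains `α_j`, except for `ε_2 + ε_1 = α_1`. -/
theorem PosRoot.exists_content_pos (β : PosRoot r) :
    ∃ u, 0 < β.content u ∧ ((u : ℕ) = β.j ∨ β.j = 2) := by
  obtain ⟨s, i, j, h1, h2, h3⟩ := β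
  by_cases h : s = true ∧ i = 1 ∧ j = 2
  · obtain ⟨rfl, rfl, rfl⟩ := h
    exact ⟨⟨1, by simp; omega⟩, by simp [PosRoot.content], Or.inr rfl⟩
  · refine ⟨⟨j, by simp; omega⟩, ?_, Or.inl rfl⟩
    cases s <;> simp only [PosRoot.content, true_and] at h ⊢ <;> split_ifs <;>
      first | contradiction | omega

theorem PosRoot.content_ne_zero (β : PosRoot r) : β.content ≠ 0 := by
  obtain ⟨u, hu, -⟩ := β.exists_content_pos
  exact fun h => hu.ne' (congrFun h u)

theorem mem_sortedList {p : PosRoot r → ℕ} {γ : PosRoot r} : γ ∈ sortedList p ↔ 0 < p γ := by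
  rw [← List.count_pos_iff, count_sortedList]

theorem j_le_of_mem_sortedList {p : PosRoot r → ℕ} {β γ : PosRoot r}
    (hp : pbwContent p = β.content) (hγ : γ ∈ sortedList p) : γ.j ≤ β.j := by
  obtain ⟨u, hu, h⟩ := γ.exists_content_pos
  have h1 : p γ * γ.content u ≤ pbwContent p u :=
    Finset.single_le_sum (f := fun γ => p γ * γ.content u) (fun _ _ => Nat.zero_le _)
      (Finset.mem_univ γ)
  have h2 : 0 < p γ * γ.content u := Nat.mul_pos (mem_sortedList.mp hγ) hu
  have h3 := PosRoot.le_j_of_content_pos (hp ▸ h2.trans_le h1)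
  have := β.lt
  have := β.one_le
  omega

theorem exists_mem_sortedList_le_j {p : PosRoot r → ℕ} {β : PosRoot r}
    (hp : pbwContent p = β.content) : ∃ γ ∈ sortedList p, β.j ≤ γ.j := by
  obtain ⟨u, hu, h⟩ := β.exists_content_pos
  rw [← hp, pbwContent] at hu
  obtain ⟨γ, -, hγ⟩ := Finset.exists_ne_zero_of_sum_ne_zero hu.ne'
  refine ⟨γ, mem_sortedList.mpr (Nat.pos_of_ne_zero (left_ne_zero_of_mul hγ)), ?_⟩
  have h3 := PosRoot.le_j_of_content_pos (Nat.pos_of_ne_zero (right_ne_zero_of_mul hγ))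
  have := γ.lt
  have := γ.one_le
  omega

theorem sortedList_single (β : PosRoot r) : sortedList (Pi.single β 1) = [β] := by
  rw [← List.perm_singleton, List.perm_iff_count]
  intro γ
  rw [count_sortedList]
  by_cases h : γ = β
  · subst h; simp
  · rw [Pi.single_eq_of_ne h, List.count_eq_zero_of_not_mem (by simpa using h)]

/-- The rightmost factor `F_γ` of a monomial of the content of `β` is a root vector with the same
`j` as `β`, because the roots are ordered by `j` first. It kills `e_a` unless `γ = β`. -/
theorem matCoeff_pbwMonomial_of_ne {p : PosRoot r → ℕ} {β : PosRoot r}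
    (hp : pbwContent p = β.content) (hne : p ≠ Pi.single β 1) :
    matCoeff β (pbwMonomial p) = 0 := by
  obtain ⟨δ, hδ, hjδ⟩ := exists_mem_sortedList_le_j hp
  have hnil : sortedList p ≠ [] := List.ne_nil_of_mem hδ
  obtain ⟨l, γ, hl⟩ : ∃ l γ, sortedList p = l ++ [γ] :=
    ⟨_, _, (List.dropLast_append_getLast hnil).symm⟩
  have hγ : γ.j = β.j := by
    refine le_antisymm (j_le_of_mem_sortedList hp (by simp [hl])) (hjδ.trans ?_)
    have hs := sortedList_pairwise p
    rw [hl, List.pairwise_append] at hs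
    rw [hl, List.mem_append, List.mem_singleton] at hδ
    rcases hδ with hδ | rfl
    · exact PosRoot.j_le_of_le (hs.2.2 δ hδ γ (List.mem_singleton_self γ))
    · exact le_rfl
  have hγβ : γ ≠ β := by
    rintro rfl
    apply hne
    rw [pbwContent_eq, hl, List.map_append, List.sum_append, List.map_singleton,
      List.sum_singleton, add_eq_right] at hp
    have hl0 : l = [] := by
      cases l with
      | nil => rfl
      | cons a l =>
        rw [List.map_cons, List.sum_cons] at hp
        refine absurd (funext fun u => ?_) a.content_ne_zero
        exact (Nat.add_eq_zero_iff.mp (congrFun hp u)).1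
    rw [hl0, List.nil_append, ← sortedList_single] at hl
    funext δ
    rw [← count_sortedList p, hl, count_sortedList]
  rw [pbwMonomial_eq, hl, List.map_append, List.prod_append, List.map_singleton,
    List.prod_singleton, matCoeff_apply, map_mul, Module.End.mul_apply, rootVec,
    vecAct_ι_vec_basisVec_source_of_ne hγ hγβ, map_zero, Pi.zero_apply]

theorem matCoeff_pbwMonomial_single (β : PosRoot r) :
    matCoeff β (pbwMonomial (Pi.single β 1)) = β.sign := by
  rw [pbwMonomial_eq, sortedList_single, List.map_singleton, List.prod_singleton, rootVec,
    matCoeff_apply, vecAct_ι_vec_basisVec_source]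
  simp

/-- Applying the matrix coefficient to an expansion extracts the atom. -/
theorem IsPBWExpansion.sign_smul_eq {β : PosRoot r} {ω : (PosRoot r → ℕ) →₀ RatFun r}
    (h : IsPBWExpansion β.content ω) :
    β.sign • ω (Pi.single β 1) = ∑ J ∈ multiIndices β.content,
      matCoeff β (quotMap r (freeMonomial J)) • sym β.content (chainFun J) := by
  let T : RatFun r ⊗[ℂ] UNil r →ₗ[ℂ] RatFun r :=
    (TensorProduct.rid ℂ (RatFun r)).toLinearMap ∘ₗ (matCoeff β).lTensor (RatFun r)
  have hT : ∀ x y, T (x ⊗ₜ y) = matCoeff β y • x := fun x y => by simp [T]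
  have h1 := congrArg T h.2
  rw [canonicalFormD, canonicalForm, map_sum, map_sum, Finsupp.sum, map_sum] at h1
  rw [Finset.sum_eq_single (Pi.single β 1), hT, matCoeff_pbwMonomial_single] at h1
  · rw [← h1]
    refine Finset.sum_congr rfl fun J _ => ?_
    rw [LinearMap.lTensor_tmul, hT]
    rfl
  · intro p hp hne
    rw [hT, matCoeff_pbwMonomial_of_ne (h.1 p hp) hne, zero_smul]
  · intro hp
    rw [Finsupp.notMem_support_iff.mp hp, TensorProduct.zero_tmul, map_zero]

/-- Existence and uniqueness of the atom, with its value as a combination of the coefficients of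
the canonical form. -/
theorem isAtom_iff (β : PosRoot r) (η : RatFun r) :
    IsAtom β η ↔ β.sign • η = ∑ J ∈ multiIndices β.content,
      matCoeff β (quotMap r (freeMonomial J)) • sym β.content (chainFun J) := by
  have hr : 2 ≤ r := by
    have := β.lt
    have := β.one_le
    have := β.le
    omega
  constructor
  · rintro ⟨ω, hω, rfl⟩
    exact hω.sign_smul_eq
  · intro h
    obtain ⟨ω, hω⟩ := exists_isPBWExpansion hr β.content
    refine ⟨ω, hω, ?_⟩
    have h1 := congrArg (β.sign • ·) (hω.sign_smul_eq.trans h.symm)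
    simpa only [smul_smul, β.sign_mul_sign, one_smul] using h1

end VectorRep

/-! ### Words with a nonzero matrix coefficient -/

noncomputable section Words

variable {r : ℕ}

/-- The operator `f_{u_n} ⋯ f_{u_1}` of a word `[u_1, …, u_n]` on the vector representation. -/
def wordOp : List ℕ → Module.End ℂ VecSpace
  | [] => 1
  | u :: l => wordOp l * genOp u

/-- The word `[J(1), …, J(n)]`. -/
def word {n : ℕ} (J : Fin n → Idx r) : List ℕ := (List.ofFn J).map Subtype.val

theorem one_le_of_mem_word {n : ℕ} {J : Fin n → Idx r} {u : ℕ} (h : u ∈ word J) : 1 ≤ u := by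
  obtain ⟨v, -, rfl⟩ := List.mem_map.mp h
  exact (Finset.mem_Icc.mp v.2).1

theorem vecAct_quotMap_freeMonomial {n : ℕ} (J : Fin n → Idx r) :
    vecAct r (quotMap r (freeMonomial J)) = wordOp (word J) := by
  rw [quotMap_freeMonomial, word]
  induction List.ofFn J with
  | nil => simp [wordOp]
  | cons u l ih =>
    have hu := Finset.mem_Icc.mp u.2
    rw [List.reverse_cons, List.map_append, List.prod_append, map_mul, ih, List.map_singleton,
      List.prod_singleton, vecAct_ι_gen hu.1 hu.2, List.map_cons, wordOp]

theorem matCoeff_freeMonomial (β : PosRoot r) {n : ℕ} (J : Fin n → Idx r) :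
    matCoeff β (quotMap r (freeMonomial J)) = wordOp (word J) (basisVec β.source) β.j := by
  rw [matCoeff_apply, vecAct_quotMap_freeMonomial]

theorem genOp_basisVec_of_pos {u : ℕ} {c : ℤ} (hu : 1 ≤ u) (hc : 1 ≤ c) :
    genOp u (basisVec c) = if (u : ℤ) = c + 1 then basisVec (c + 1) else 0 := by
  rcases eq_or_ne u 1 with rfl | h1
  · rw [genOp_one, rootOp_basisVec, if_neg (by omega), if_neg (by omega), if_neg (by omega),
      sub_zero]
  · rw [genOp_of_ne h1, rootOp_basisVec, if_neg (by omega : ¬ c = -(u : ℤ)), sub_zero]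
    by_cases h : (u : ℤ) = c + 1
    · rw [if_pos h, if_pos (by omega), h]
    · rw [if_neg h, if_neg (by omega)]

theorem genOp_basisVec_neg_one {u : ℕ} (hu : 1 ≤ u) :
    genOp u (basisVec (-1)) = if u = 1 then basisVec 2 else 0 := by
  rcases eq_or_ne u 1 with rfl | h1
  · rw [genOp_one, rootOp_basisVec, if_pos rfl, if_neg (by omega), if_pos rfl, sub_zero]
  · rw [genOp_of_ne h1, rootOp_basisVec, if_neg (by omega), if_neg (by omega), if_neg h1, sub_zero]

theorem genOp_basisVec_neg_two {u : ℕ} (hu : 1 ≤ u) :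
    genOp u (basisVec (-2)) =
      if u = 1 then -basisVec 1 else if u = 2 then -basisVec (-1) else 0 := by
  rcases eq_or_ne u 1 with rfl | h1
  · rw [genOp_one, rootOp_basisVec, if_neg (by omega), if_pos rfl, if_pos rfl, zero_sub, neg_neg]
  · rw [genOp_of_ne h1, rootOp_basisVec, if_neg (by omega), if_neg h1, zero_sub]
    by_cases h : u = 2
    · subst h
      simp
    · rw [if_neg h, if_neg (by omega), neg_zero]

theorem genOp_basisVec_neg {u c : ℕ} (hu : 1 ≤ u) (hc : 2 ≤ c) :
    genOp u (basisVec (-(c + 1 : ℕ))) = if u = c + 1 then -basisVec (-c) else 0 := by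
  rcases eq_or_ne u 1 with rfl | h1
  · rw [genOp_one, rootOp_basisVec, if_neg (by omega), if_neg (by omega), if_neg (by omega),
      sub_zero]
  · rw [genOp_of_ne h1, rootOp_basisVec, if_neg (by omega), zero_sub]
    by_cases h : u = c + 1
    · subst h
      rw [if_pos rfl, if_pos rfl, Nat.cast_succ, add_sub_cancel_right]
    · rw [if_neg h, if_neg (by omega), neg_zero]

theorem coeff_wordOp_pos {l : List ℕ} (hl : ∀ u ∈ l, 1 ≤ u) {c : ℕ} (hc : 1 ≤ c) (j : ℕ) :
    wordOp l (basisVec c) j = if l = List.range' (c + 1) (j - c) ∧ c ≤ j then 1 else 0 := by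
  induction l generalizing c with
  | nil =>
    have h : ([] = List.range' (c + 1) (j - c) ∧ c ≤ j) ↔ (j : ℤ) = c := by
      rw [eq_comm, List.range'_eq_nil_iff]
      omega
    simp only [h, wordOp, Module.End.one_apply, Pi.single_apply]
  | cons u l ih =>
    have hu := hl u List.mem_cons_self
    rw [wordOp, Module.End.mul_apply, genOp_basisVec_of_pos hu (by omega)]
    by_cases h : u = c + 1
    · have h' : (u :: l = List.range' (c + 1) (j - c) ∧ c ≤ j) ↔
          (l = List.range' (c + 1 + 1) (j - (c + 1)) ∧ c + 1 ≤ j) := by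
        rcases le_or_gt (c + 1) j with hj | hj
        · rw [show j - c = (j - (c + 1)) + 1 by omega, List.range'_succ, h, List.cons_inj_right]
          simp [hj, (Nat.le_succ c).trans hj]
        · rw [show j - c = 0 by omega]
          simp only [List.range'_zero, reduceCtorEq, false_and, false_iff]
          omega
      rw [if_pos (by omega), ← Nat.cast_succ,
        ih (fun v hv => hl v (List.mem_cons_of_mem _ hv)) (by omega)]
      simp only [h']
    · rw [if_neg (by omega), map_zero, if_neg]
      · rfl
      · rintro ⟨h1, h2⟩
        rcases hj : j - c with _ | n
        · simp [hj] at h1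
        · rw [hj, List.range'_succ, List.cons_eq_cons] at h1
          exact h h1.1

theorem coeff_wordOp_neg_one {l : List ℕ} (hl : ∀ u ∈ l, 1 ≤ u) {j : ℕ} (hj : 2 ≤ j) :
    wordOp l (basisVec (-1)) j = if l = 1 :: List.range' 3 (j - 2) then 1 else 0 := by
  match l with
  | [] => simp [wordOp]
  | u :: l =>
    have hu := hl u List.mem_cons_self
    rw [wordOp, Module.End.mul_apply, genOp_basisVec_neg_one hu]
    by_cases h : u = 1
    · have := coeff_wordOp_pos (fun v hv => hl v (List.mem_cons_of_mem u hv)) one_le_two j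
      rw [if_pos h, h]
      simpa [hj] using this
    · rw [if_neg h, map_zero, if_neg, Pi.zero_apply]
      exact fun h' => h (List.cons_eq_cons.mp h').1

/-- The words of the two paths from `e_{-i}` to `e_j`: down to `e_{-2}`, on to `e_2` through
`e_{-1}` or `e_1` by the letters `x` and `y`, and up to `e_j`. -/
def plusWord (x y i j : ℕ) : List ℕ :=
  (List.range' 3 (i - 2)).reverse ++ x :: y :: List.range' 3 (j - 2)

theorem coeff_wordOp_neg {l : List ℕ} (hl : ∀ u ∈ l, 1 ≤ u) {i j : ℕ} (hi : 2 ≤ i) (hj : 2 ≤ j) :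
    wordOp l (basisVec (-i)) j =
      if l = plusWord 2 1 i j ∨ l = plusWord 1 2 i j then (-1) ^ (i + 1) else 0 := by
  induction i, hi using Nat.le_induction generalizing l with
  | base =>
    match l with
    | [] => simp [wordOp, plusWord]
    | u :: l =>
      have hu := hl u List.mem_cons_self
      have hl' : ∀ v ∈ l, 1 ≤ v := fun v hv => hl v (List.mem_cons_of_mem u hv)
      rw [wordOp, Module.End.mul_apply]
      have h2 : ((2 : ℕ) : ℤ) = 2 := rfl
      rw [h2, genOp_basisVec_neg_two hu]
      have e1 := coeff_wordOp_pos hl' le_rfl j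
      have e2 := coeff_wordOp_neg_one hl' hj
      have e3 : List.range' 2 (j - 1) = 2 :: List.range' 3 (j - 2) := by
        rw [show j - 1 = j - 2 + 1 by omega, List.range'_succ]
      rw [e3] at e1
      by_cases h : u = 1
      · subst h
        rw [if_pos rfl, map_neg, Pi.neg_apply]
        have hj1 : 1 ≤ j := by omega
        simp only [Nat.cast_one, hj1, and_true] at e1
        rw [e1]
        by_cases hl2 : l = 2 :: List.range' 3 (j - 2) <;> simp [plusWord, hl2, pow_succ]
      · rw [if_neg h]
        by_cases h2 : u = 2
        · subst h2
          rw [if_pos rfl, map_neg, Pi.neg_apply, e2]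
          by_cases hl2 : l = 1 :: List.range' 3 (j - 2) <;> simp [plusWord, hl2, pow_succ]
        · rw [if_neg h2, map_zero, if_neg]
          · rfl
          · simp [plusWord, h, h2]
  | succ i hi ih =>
    have hw : ∀ x y, plusWord x y (i + 1) j = (i + 1) :: plusWord x y i j := by
      intro x y
      rw [plusWord, plusWord, show i + 1 - 2 = i - 2 + 1 by omega, List.range'_concat,
        List.reverse_append, List.reverse_singleton, List.singleton_append, List.cons_append]
      congr 1
      omega
    rw [hw, hw]
    match l with
    | [] => simp [wordOp, Pi.single_apply]; omega
    | u :: l =>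
      have hu := hl u List.mem_cons_self
      rw [wordOp, Module.End.mul_apply, genOp_basisVec_neg hu hi]
      by_cases h : u = i + 1
      · rw [if_pos h, map_neg, Pi.neg_apply,
          ih (fun v hv => hl v (List.mem_cons_of_mem u hv)), h, pow_succ _ (i + 1)]
        simp only [List.cons_inj_right]
        split_ifs <;> simp
      · rw [if_neg h, map_zero, if_neg]
        · rfl
        · simp [h]

end Words

/-! ### The chain of a word -/

noncomputable section Chains

variable {r : ℕ}

/-- The product of the `1 / (t_s - t_{s-1})` along a word, when the variable before the word is
`prev` and the letter `u` has already occurred `c u` times. -/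
def chain (r : ℕ) (prev : RatFun r) (c : ℕ → ℕ) : List ℕ → RatFun r
  | [] => 1
  | u :: l => 1 / (t r u (c u + 1) - prev) *
      chain r (t r u (c u + 1)) (Function.update c u (c u + 1)) l

theorem position_zero {n : ℕ} (J : Fin (n + 1) → Idx r) : position J 0 = 1 := by
  rw [position, Finset.card_eq_one]
  refine ⟨0, ?_⟩
  ext s
  simp +contextual

theorem position_succ {n : ℕ} (J : Fin (n + 1) → Idx r) (s : Fin n) :
    position J s.succ =
      (if J 0 = J s.succ then 1 else 0) + position (fun s => J s.succ) s := by
  simp only [position, Finset.card_filter]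
  rw [Fin.sum_univ_succ]
  simp

theorem prod_eq_chain {n : ℕ} (J : Fin n → Idx r) (prev : RatFun r) (c : ℕ → ℕ) :
    ∏ s : Fin n, 1 / (t r (J s) (c (J s) + position J s) -
      if (s : ℕ) = 0 then prev else
        t r (J ⟨s - 1, by omega⟩) (c (J ⟨s - 1, by omega⟩) + position J ⟨s - 1, by omega⟩)) =
    chain r prev c (word J) := by
  induction n generalizing prev c with
  | zero => simp [word, chain]
  | succ n ih =>
    have hw : word J = (J 0 : ℕ) :: word fun s => J s.succ := by
      rw [word, List.ofFn_succ, List.map_cons, word]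
    have hc : ∀ s : Fin n, c (J s.succ) + position J s.succ =
        Function.update c (J 0 : ℕ) (c (J 0) + 1) (J s.succ) + position (fun s => J s.succ) s := by
      intro s
      rw [position_succ]
      by_cases h : J 0 = J s.succ
      · rw [if_pos h, ← h, Function.update_self, add_assoc]
      · rw [if_neg h, Function.update_of_ne, zero_add]
        exact fun h' => h (Subtype.ext h'.symm)
    rw [hw, chain, ← ih, Fin.prod_univ_succ]
    congr 1
    · rw [position_zero]
      simp
    · refine Finset.prod_congr rfl fun s _ => ?_
      rw [hc]
      congr 2
      rcases n with _ | n
      · exact s.elim0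
      cases s using Fin.cases with
      | zero =>
        have := position_zero J
        simpa using congrArg (fun p => t r (J 0) (c (J 0) + p)) this
      | succ s =>
        have := hc s.castSucc
        rw [if_neg (by simp), if_neg (by simp)]
        exact congrArg (t r (J s.castSucc.succ)) this

theorem chainFun_eq_chain {n : ℕ} (J : Fin n → Idx r) :
    chainFun J = chain r 0 0 (word J) := by
  rw [← prod_eq_chain]
  simp [chainFun, posVar, prevVar]

theorem chain_range' (prev : RatFun r) (c : ℕ → ℕ) (a n : ℕ) :
    chain r prev c (List.range' a (n + 1)) = 1 / (t r a (c a + 1) - prev) *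
      ∏ u ∈ Finset.Icc (a + 1) (a + n), 1 / (t r u (c u + 1) - t r (u - 1) (c (u - 1) + 1)) := by
  induction n generalizing prev c a with
  | zero => simp [chain]
  | succ n ih =>
    rw [List.range'_succ, chain, ih,
      ← Finset.mul_prod_Ioc_eq_prod_Icc (by omega : a + 1 ≤ a + (n + 1))]
    congr 2
    · rw [Function.update_of_ne (by omega), Nat.add_sub_cancel]
    · refine Finset.prod_congr ?_ fun u hu => ?_
      · ext u
        simp only [Finset.mem_Icc, Finset.mem_Ioc]
        omega
      · rw [Finset.mem_Ioc] at hu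
        rw [Function.update_of_ne (by omega), Function.update_of_ne (by omega)]

theorem chain_range'_reverse_append (prev : RatFun r) (c : ℕ → ℕ) (a n : ℕ) (l : List ℕ) :
    chain r prev c ((List.range' a (n + 1)).reverse ++ l) =
      1 / (t r (a + n) (c (a + n) + 1) - prev) *
      (∏ u ∈ Finset.Ico a (a + n), 1 / (t r u (c u + 1) - t r (u + 1) (c (u + 1) + 1))) *
      chain r (t r a (c a + 1)) (fun u => if a ≤ u ∧ u ≤ a + n then c u + 1 else c u) l := by
  induction n generalizing prev c with
  | zero =>
    simp only [zero_add, List.range'_one, List.reverse_singleton, List.singleton_append, chain,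
      add_zero, Finset.Ico_self, Finset.prod_empty, mul_one]
    congr 2
    ext u
    rcases eq_or_ne u a with rfl | h
    · simp
    · rw [Function.update_of_ne h, if_neg (by omega)]
  | succ n ih =>
    rw [List.range'_concat, List.reverse_append, List.reverse_singleton, List.singleton_append,
      List.cons_append, one_mul, chain, ih]
    have h0 := Finset.prod_Ico_succ_top (Nat.le_add_right a n)
      fun u => 1 / (t r u (c u + 1) - t r (u + 1) (c (u + 1) + 1))
    have h1 : Function.update c (a + (n + 1)) (c (a + (n + 1)) + 1) (a + n) = c (a + n) :=
      Function.update_of_ne (by omega) _ _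
    have h2 : Function.update c (a + (n + 1)) (c (a + (n + 1)) + 1) a = c a :=
      Function.update_of_ne (by omega) _ _
    have h3 : ∏ u ∈ Finset.Ico a (a + n),
        1 / (t r u (Function.update c (a + (n + 1)) (c (a + (n + 1)) + 1) u + 1) -
          t r (u + 1) (Function.update c (a + (n + 1)) (c (a + (n + 1)) + 1) (u + 1) + 1)) =
        ∏ u ∈ Finset.Ico a (a + n), 1 / (t r u (c u + 1) - t r (u + 1) (c (u + 1) + 1)) := by
      refine Finset.prod_congr rfl fun u hu => ?_
      rw [Finset.mem_Ico] at hu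
      rw [Function.update_of_ne (by omega), Function.update_of_ne (by omega)]
    have h4 : (fun u => if a ≤ u ∧ u ≤ a + n then
          Function.update c (a + (n + 1)) (c (a + (n + 1)) + 1) u + 1
        else Function.update c (a + (n + 1)) (c (a + (n + 1)) + 1) u) =
        fun u => if a ≤ u ∧ u ≤ a + (n + 1) then c u + 1 else c u := by
      ext u
      rcases eq_or_ne u (a + (n + 1)) with rfl | h
      · rw [if_neg (by omega), if_pos (by omega), Function.update_self]
      · rw [Function.update_of_ne h]
        split_ifs <;> omega
    rw [add_assoc] at h0
    rw [h0, h1, h2, h3, h4]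
    ring

end Chains

/-! ### Symmetrization -/

noncomputable section Sym

variable {r : ℕ}

theorem t_of_mem {u : ℕ} (h : u ∈ Finset.Icc 1 r) (a : ℕ) :
    t r u a = algebraMap (MvPolynomial (Idx r × ℕ) ℂ) (RatFun r) (MvPolynomial.X (⟨u, h⟩, a)) :=
  dif_pos h

theorem t_ne_zero {u a : ℕ} (hu : 1 ≤ u) (hr : u ≤ r) : t r u a ≠ 0 := by
  rw [t_of_mem (Finset.mem_Icc.mpr ⟨hu, hr⟩)]
  exact (map_ne_zero_iff _ (IsFractionRing.injective _ _)).mpr (MvPolynomial.X_ne_zero _)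

theorem t_sub_t_ne_zero {u v a b : ℕ} (hu : 1 ≤ u) (hur : u ≤ r) (hv : 1 ≤ v) (hvr : v ≤ r)
    (h : ¬ (u = v ∧ a = b)) : t r u a - t r v b ≠ 0 := by
  rw [sub_ne_zero, t_of_mem (Finset.mem_Icc.mpr ⟨hu, hur⟩),
    t_of_mem (Finset.mem_Icc.mpr ⟨hv, hvr⟩)]
  intro h'
  have := MvPolynomial.X_injective (IsFractionRing.injective _ (RatFun r) h')
  simp only [Prod.mk.injEq, Subtype.mk.injEq] at this
  exact h this

theorem permAct_algebraMap {k : Idx r → ℕ} (π : SymGroup k) (p : MvPolynomial (Idx r × ℕ) ℂ) :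
    permAct π (algebraMap _ (RatFun r) p) =
      algebraMap _ (RatFun r) (MvPolynomial.rename (permVars π) p) :=
  IsFractionRing.ringEquivOfRingEquiv_algebraMap _ p

theorem permVars_mul {k : Idx r → ℕ} (π ρ : SymGroup k) :
    ⇑(permVars (π * ρ)) = permVars π ∘ permVars ρ := by
  funext x
  simp [permVars, Equiv.prodCongrRight, Equiv.Perm.mul_apply]

theorem permAct_mul {k : Idx r → ℕ} (π ρ : SymGroup k) (x : RatFun r) :
    permAct (π * ρ) x = permAct π (permAct ρ x) := by
  obtain ⟨p, q, -, rfl⟩ := IsFractionRing.div_surjective (MvPolynomial (Idx r × ℕ) ℂ) x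
  simp only [map_div₀, permAct_algebraMap, MvPolynomial.rename_rename, permVars_mul]

theorem permAct_one {k : Idx r → ℕ} (x : RatFun r) : permAct (1 : SymGroup k) x = x := by
  have h : ⇑(permVars (1 : SymGroup k)) = id := by
    ext x <;> simp [permVars]
  obtain ⟨p, q, -, rfl⟩ := IsFractionRing.div_surjective (MvPolynomial (Idx r × ℕ) ℂ) x
  simp only [map_div₀, permAct_algebraMap, h, MvPolynomial.rename_id, AlgHom.id_apply]

theorem sym_permAct {k : Idx r → ℕ} (π : SymGroup k) (x : RatFun r) :
    sym k (permAct π x) = sym k x := by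
  rw [sym, sym, ← Equiv.sum_comp (Equiv.mulRight π) fun ρ => permAct ρ x]
  simp only [Equiv.coe_mulRight, permAct_mul]

theorem sym_add (k : Idx r → ℕ) (x y : RatFun r) : sym k (x + y) = sym k x + sym k y := by
  simp only [sym, map_add, Finset.sum_add_distrib]

theorem sym_eq_self {k : Idx r → ℕ} (hk : ∀ u, k u ≤ 1) (x : RatFun r) : sym k x = x := by
  have : ∀ u, Subsingleton {a : ℕ // a ∈ Finset.Icc 1 (k u)} := fun u => by
    refine ⟨fun a b => Subtype.ext ?_⟩
    have ha := Finset.mem_Icc.mp a.2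
    have hb := Finset.mem_Icc.mp b.2
    have := hk u
    omega
  rw [sym, Fintype.sum_eq_single (1 : SymGroup k), permAct_one]
  intro π hπ
  exact absurd (Subsingleton.elim _ _) hπ

/-- The permutation that exchanges `t^{(u)}_1` and `t^{(u)}_2` for all `u` with `k_u ≥ 2`. -/
def swapVars (k : Idx r → ℕ) : SymGroup k := fun u =>
  if h : 2 ≤ k u then
    Equiv.swap ⟨1, Finset.mem_Icc.mpr ⟨le_rfl, one_le_two.trans h⟩⟩
      ⟨2, Finset.mem_Icc.mpr ⟨one_le_two, h⟩⟩
  else 1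

theorem permAct_swapVars_t (k : Idx r → ℕ) (u : Idx r) (a : ℕ) :
    permAct (swapVars k) (t r u a) = t r u (if 2 ≤ k u then Equiv.swap 1 2 a else a) := by
  rw [t_of_mem u.2, t_of_mem u.2, permAct_algebraMap, MvPolynomial.rename_X]
  congr 2
  simp only [permVars, Equiv.prodCongrRight_apply, swapVars, Subtype.coe_eta]
  congr 1
  split_ifs
  · rw [Equiv.Perm.ofSubtype_swap_eq]
  · simp

end Sym

/-! ### The canonical form and words -/

noncomputable section WordSum

variable {r : ℕ}

theorem count_ofFn {α : Type*} [DecidableEq α] [BEq α] [LawfulBEq α] {n : ℕ} (f : Fin n → α)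
    (a : α) : (List.ofFn f).count a = (Finset.univ.filter fun s => f s = a).card := by
  rw [Finset.card_filter]
  induction n with
  | zero => simp
  | succ n ih => rw [List.ofFn_succ, List.count_cons, ih, Fin.sum_univ_succ, add_comm]; simp

theorem sum_count_eq_length {α : Type*} [Fintype α] [BEq α] [LawfulBEq α] (l : List α) :
    ∑ a, l.count a = l.length := by
  classical
  induction l with
  | nil => simp
  | cons b l ih => simp [List.count_cons, Finset.sum_add_distrib, ih]

/-- A word with `k_u` letters `u` for each `u` comes from a multi-index of weight `k`. -/
theorem exists_multiIndex {k : Idx r → ℕ} {w : List ℕ} (hw : ∀ u ∈ w, u ∈ Finset.Icc 1 r)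
    (hk : ∀ u : Idx r, w.count (u : ℕ) = k u) : ∃ J ∈ multiIndices k, word J = w := by
  lift w to List (Idx r) using hw
  have hk' : ∀ u, w.count u = k u := fun u => by
    rw [← hk, List.count_map_of_injective _ _ Subtype.val_injective]
  have hlen : ∑ u, k u = w.length := by
    simp only [← hk']
    exact sum_count_eq_length w
  have hJ : ∃ J : Fin (∑ u, k u) → Idx r, List.ofFn J = w := by
    rw [hlen]
    exact ⟨w.get, List.ofFn_get w⟩
  obtain ⟨J, hJ⟩ := hJ
  refine ⟨J, ?_, by rw [word, hJ]⟩
  rw [multiIndices, Finset.mem_filter]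
  refine ⟨Finset.mem_univ _, fun u => ?_⟩
  rw [← hk', ← hJ, count_ofFn]

theorem word_injective {n : ℕ} : Function.Injective (word : (Fin n → Idx r) → List ℕ) :=
  fun _ _ h => List.ofFn_injective (List.map_injective_iff.mpr Subtype.val_injective h)

theorem sum_ite_word_smul {k : Idx r → ℕ} {w : List ℕ} (hw : ∀ u ∈ w, u ∈ Finset.Icc 1 r)
    (hk : ∀ u : Idx r, w.count (u : ℕ) = k u) (c : ℂ) :
    ∑ J ∈ multiIndices k, (if word J = w then c else 0) • sym k (chainFun J) =
      c • sym k (chain r 0 0 w) := by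
  obtain ⟨J, hJ, rfl⟩ := exists_multiIndex hw hk
  rw [Finset.sum_eq_single J, if_pos rfl, chainFun_eq_chain]
  · intro J' _ hne
    rw [if_neg (word_injective.ne hne), zero_smul]
  · exact fun h => absurd hJ h

end WordSum

/-! ### The atoms -/

noncomputable section Atoms

variable {r : ℕ}

theorem count_range' (a n u : ℕ) :
    (List.range' a n).count u = if a ≤ u ∧ u < a + n then 1 else 0 := by
  rw [(List.nodup_range').count]
  simp only [List.mem_range'_1]

theorem prod_one_div {K ι : Type*} [Field K] (s : Finset ι) (f : ι → K) :
    ∏ u ∈ s, 1 / f u = 1 / ∏ u ∈ s, f u := by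
  simp only [one_div, Finset.prod_inv_distrib]

/-- The atom at a root without multiplicities for which only one word leads from the source to
`e_j`: it is the chain of that word. -/
theorem isAtom_iff_of_word {β : PosRoot r} {w : List ℕ} (hβ : ∀ u, β.content u ≤ 1)
    (hw : ∀ u ∈ w, u ∈ Finset.Icc 1 r) (hk : ∀ u : Idx r, w.count (u : ℕ) = β.content u)
    (hs : β.sign = 1)
    (hcoeff : ∀ l : List ℕ, (∀ u ∈ l, 1 ≤ u) →
      wordOp l (basisVec β.source) β.j = if l = w then 1 else 0) (η : RatFun r) :
    IsAtom β η ↔ η = chain r 0 0 w := by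
  have h : ∀ J : Fin (∑ u, β.content u) → Idx r,
      matCoeff β (quotMap r (freeMonomial J)) = if word J = w then 1 else 0 := fun J => by
    rw [matCoeff_freeMonomial, hcoeff _ fun u hu => one_le_of_mem_word hu]
  simp only [isAtom_iff, h]
  rw [sum_ite_word_smul hw hk, sym_eq_self hβ, hs, one_smul, one_smul]

theorem isAtom_minus_iff {i j : ℕ} (h1 : 1 ≤ i) (hij : i < j) (hj : j ≤ r) (η : RatFun r) :
    IsAtom ⟨false, i, j, h1, hij, hj⟩ η ↔
      η = 1 / (t r (i + 1) 1 * ∏ u ∈ Finset.Icc (i + 2) j, (t r u 1 - t r (u - 1) 1)) := by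
  rw [isAtom_iff_of_word (w := List.range' (i + 1) (j - i))]
  · rw [show j - i = j - i - 1 + 1 by omega, chain_range', prod_one_div,
      show i + 1 + (j - i - 1) = j by omega, sub_zero, one_div_mul_one_div]
    rfl
  · intro u
    simp only [PosRoot.content]
    split_ifs <;> omega
  · intro u hu
    rw [List.mem_range'_1] at hu
    rw [Finset.mem_Icc]
    omega
  · intro u
    rw [count_range']
    simp only [PosRoot.content, if_true]
    congr 1
    rw [eq_iff_iff]
    omega
  · rfl
  · intro l hl
    have := coeff_wordOp_pos hl h1 j
    simpa [hij.le, PosRoot.source] using this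

theorem isAtom_plus_one_iff {j : ℕ} (h1j : 1 < j) (hj : j ≤ r) (η : RatFun r) :
    IsAtom ⟨true, 1, j, le_rfl, h1j, hj⟩ η ↔
      η = 1 / (t r 1 1 * ∏ u ∈ Finset.Icc 3 j, (t r u 1 - t r (if u = 3 then 1 else u - 1) 1)) := by
  rw [isAtom_iff_of_word (w := 1 :: List.range' 3 (j - 2))]
  · rw [chain, sub_zero]
    rcases Nat.eq_or_lt_of_le h1j with rfl | h2j
    · simp [chain]
    · have h3 : ∏ u ∈ Finset.Ioc 3 j, (t r u 1 - t r (if u = 3 then 1 else u - 1) 1) =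
          ∏ u ∈ Finset.Icc 4 j, (t r u 1 - t r (u - 1) 1) := by
        refine Finset.prod_congr ?_ fun u hu => ?_
        · ext u
          simp only [Finset.mem_Icc, Finset.mem_Ioc]
          omega
        · rw [if_neg]
          rw [Finset.mem_Icc] at hu
          omega
      have h4 : ∀ u, 2 ≤ u → Function.update (0 : ℕ → ℕ) 1 ((0 : ℕ → ℕ) 1 + 1) u = 0 := fun u hu =>
        Function.update_of_ne (by omega) _ _
      have h5 : ∏ u ∈ Finset.Icc (3 + 1) j,
          1 / (t r u (Function.update (0 : ℕ → ℕ) 1 ((0 : ℕ → ℕ) 1 + 1) u + 1) -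
            t r (u - 1) (Function.update (0 : ℕ → ℕ) 1 ((0 : ℕ → ℕ) 1 + 1) (u - 1) + 1)) =
          1 / ∏ u ∈ Finset.Icc 4 j, (t r u 1 - t r (u - 1) 1) := by
        rw [← prod_one_div]
        refine Finset.prod_congr rfl fun u hu => ?_
        rw [Finset.mem_Icc] at hu
        rw [h4 u (by omega), h4 (u - 1) (by omega)]
      rw [show j - 2 = j - 3 + 1 by omega, chain_range', show 3 + (j - 3) = j by omega, h5,
        h4 3 (by omega), ← Finset.mul_prod_Ioc_eq_prod_Icc (by omega : 3 ≤ j), h3, if_pos rfl,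
        one_div_mul_one_div, one_div_mul_one_div]
      rfl
  · intro u
    simp only [PosRoot.content]
    split_ifs <;> omega
  · intro u hu
    rw [List.mem_cons, List.mem_range'_1] at hu
    rw [Finset.mem_Icc]
    omega
  · intro u
    have := (Finset.mem_Icc.mp u.2).1
    rw [List.count_cons, count_range']
    simp only [PosRoot.content, beq_iff_eq]
    split_ifs <;> first | contradiction | omega
  · simp [PosRoot.sign]
  · intro l hl
    have := coeff_wordOp_neg_one hl h1j
    simpa [PosRoot.source] using this

/-- The final part of the chain of `plusWord`: `x` and `y` are the nodes `1` and `2` in either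
order, and the nodes from `3` on follow. -/
theorem chain_fork {x y : ℕ} (hx : x < 3) (hy : y < 3) (hxy : x ≠ y) (prev : RatFun r) {c : ℕ → ℕ}
    (hcx : c x = 0) (hcy : c y = 0) {j : ℕ} (hj : 3 ≤ j) :
    chain r prev c (x :: y :: List.range' 3 (j - 2)) =
      1 / (t r x 1 - prev) * (1 / (t r y 1 - t r x 1) * (1 / (t r 3 (c 3 + 1) - t r y 1) *
        (1 / ∏ u ∈ Finset.Icc 4 j, (t r u (c u + 1) - t r (u - 1) (c (u - 1) + 1))))) := by
  set c' := Function.update c x (c x + 1) with hc'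
  have h1 : c' y = 0 := (Function.update_of_ne hxy.symm _ _).trans hcy
  have h2 : ∀ u, 3 ≤ u → Function.update c' y (c' y + 1) u = c u := fun u hu => by
    rw [Function.update_of_ne (by omega), hc', Function.update_of_ne (by omega)]
  have h3 : ∏ u ∈ Finset.Icc (3 + 1) j, 1 / (t r u (Function.update c' y (c' y + 1) u + 1) -
        t r (u - 1) (Function.update c' y (c' y + 1) (u - 1) + 1)) =
      1 / ∏ u ∈ Finset.Icc 4 j, (t r u (c u + 1) - t r (u - 1) (c (u - 1) + 1)) := by
    rw [← prod_one_div]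
    refine Finset.prod_congr rfl fun u hu => ?_
    rw [Finset.mem_Icc] at hu
    rw [h2 u (by omega), h2 (u - 1) (by omega)]
  rw [chain, chain, ← hc', show j - 2 = j - 3 + 1 by omega, chain_range',
    show 3 + (j - 3) = j by omega, h3, h2 3 le_rfl, h1, hcx, zero_add]

/-- The partial fraction identity that merges the contributions of the two paths. -/
theorem partial_fractions {K : Type*} [Field K] {a b x y : K} (s p q : K) (hxy : x - y ≠ 0)
    (hax : a - x ≠ 0) (hay : a - y ≠ 0) (hxb : x - b ≠ 0) (hyb : y - b ≠ 0) :
    1 / s * (1 / p) * (1 / (y - b) * (1 / (x - y) * (1 / (a - x) * (1 / q)))) +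
      1 / s * (1 / p) * (1 / (x - b) * (1 / (y - x) * (1 / (a - y) * (1 / q)))) =
    (a - b) / (s * (x - b) * (y - b) * (a - x) * (a - y) * p * q) := by
  have hyx : y - x = -(x - y) := (neg_sub x y).symm
  have key : 1 / (y - b) * (1 / (x - y) * (1 / (a - x))) +
      1 / (x - b) * (1 / (y - x) * (1 / (a - y))) =
      (a - b) / ((x - b) * (y - b) * (a - x) * (a - y)) := by
    rw [hyx]
    field_simp
    ring
  calc _ = (1 / s * (1 / p) * (1 / q)) * (1 / (y - b) * (1 / (x - y) * (1 / (a - x))) +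
      1 / (x - b) * (1 / (y - x) * (1 / (a - y)))) := by ring
    _ = _ := by
      rw [key]
      simp only [div_eq_mul_inv, mul_inv]
      ring

theorem mem_Icc_of_mem_plusWord {x y i j u : ℕ} (hx1 : 1 ≤ x) (hx : x < 3) (hy1 : 1 ≤ y)
    (hy : y < 3) (hi : 2 ≤ i) (hij : i < j) (hj : j ≤ r) (hu : u ∈ plusWord x y i j) :
    u ∈ Finset.Icc 1 r := by
  rw [plusWord, List.mem_append, List.mem_reverse, List.mem_cons, List.mem_cons, List.mem_range'_1,
    List.mem_range'_1] at hu
  rw [Finset.mem_Icc]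
  omega

theorem count_plusWord {x y i j : ℕ} (hxy : x = 1 ∧ y = 2 ∨ x = 2 ∧ y = 1) (h1 : 1 ≤ i)
    (hi : 2 ≤ i) (hij : i < j) (hj : j ≤ r) (u : Idx r) :
    (plusWord x y i j).count (u : ℕ) = PosRoot.content ⟨true, i, j, h1, hij, hj⟩ u := by
  have := (Finset.mem_Icc.mp u.2).1
  rw [plusWord, List.count_append, List.count_reverse, List.count_cons, List.count_cons,
    count_range', count_range']
  simp only [PosRoot.content, beq_iff_eq]
  split_ifs <;> first | contradiction | omega

theorem isAtom_plus_iff {i j : ℕ} (h1 : 1 ≤ i) (hi : 2 ≤ i) (hij : i < j) (hj : j ≤ r)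
    (η : RatFun r) :
    IsAtom ⟨true, i, j, h1, hij, hj⟩ η ↔
      η = sym (PosRoot.content ⟨true, i, j, h1, hij, hj⟩)
        (chain r 0 0 (plusWord 2 1 i j) + chain r 0 0 (plusWord 1 2 i j)) := by
  set β : PosRoot r := ⟨true, i, j, h1, hij, hj⟩
  have hne : plusWord 2 1 i j ≠ plusWord 1 2 i j := by simp [plusWord]
  have h : ∀ J : Fin (∑ u, β.content u) → Idx r,
      matCoeff β (quotMap r (freeMonomial J)) =
        (if word J = plusWord 2 1 i j then β.sign else 0) +
          if word J = plusWord 1 2 i j then β.sign else 0 := fun J => by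
    have hc := coeff_wordOp_neg (fun u hu => one_le_of_mem_word (J := J) hu) hi (hi.trans hij.le)
    have hs : β.sign = (-1) ^ (i + 1) := if_pos rfl
    have hsrc : β.source = -i := if_pos rfl
    rw [matCoeff_freeMonomial, hs, hsrc]
    refine hc.trans ?_
    generalize word J = l
    by_cases e1 : l = plusWord 2 1 i j
    · rw [if_pos (Or.inl e1), if_pos e1, if_neg (e1 ▸ hne), add_zero]
    · simp only [e1, false_or, if_false, zero_add]
  simp only [isAtom_iff, h, add_smul, Finset.sum_add_distrib]
  rw [sum_ite_word_smul, sum_ite_word_smul, ← smul_add, ← sym_add]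
  · constructor
    · intro h'
      have := congrArg (β.sign • ·) h'
      simpa only [smul_smul, β.sign_mul_sign, one_smul] using this
    · rintro rfl
      rfl
  · exact fun u => mem_Icc_of_mem_plusWord (by omega) (by omega) (by omega) (by omega) hi hij hj
  · exact count_plusWord (Or.inl ⟨rfl, rfl⟩) h1 hi hij hj
  · exact fun u => mem_Icc_of_mem_plusWord (by omega) (by omega) (by omega) (by omega) hi hij hj
  · exact count_plusWord (Or.inr ⟨rfl, rfl⟩) h1 hi hij hj

theorem isAtom_plus_two_iff {j : ℕ} (h1 : 1 ≤ 2) (h2j : 2 < j) (hj : j ≤ r) (η : RatFun r) :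
    IsAtom ⟨true, 2, j, h1, h2j, hj⟩ η ↔
      η = sym (PosRoot.content ⟨true, 2, j, h1, h2j, hj⟩)
        (t r 3 1 / (t r 1 1 * t r 2 1 * (t r 3 1 - t r 1 1) * (t r 3 1 - t r 2 1) *
          ∏ u ∈ Finset.Icc 4 j, (t r u 1 - t r (u - 1) 1))) := by
  rw [isAtom_plus_iff h1 le_rfl h2j hj]
  have hw : ∀ x y, plusWord x y 2 j = x :: y :: List.range' 3 (j - 2) := fun x y => rfl
  have hpf := partial_fractions (a := t r 3 1) (b := 0) (x := t r 1 1) (y := t r 2 1) 1 1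
    (∏ u ∈ Finset.Icc 4 j, (t r u 1 - t r (u - 1) 1))
    (t_sub_t_ne_zero le_rfl (by omega) (by omega) (by omega) (by omega))
    (t_sub_t_ne_zero (by omega) (by omega) (by omega) (by omega) (by omega))
    (t_sub_t_ne_zero (by omega) (by omega) (by omega) (by omega) (by omega))
    (by rw [sub_zero]; exact t_ne_zero (by omega) (by omega))
    (by rw [sub_zero]; exact t_ne_zero (by omega) (by omega))
  have hsum : chain r 0 0 (plusWord 2 1 2 j) + chain r 0 0 (plusWord 1 2 2 j) =
      t r 3 1 / (t r 1 1 * t r 2 1 * (t r 3 1 - t r 1 1) * (t r 3 1 - t r 2 1) *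
          ∏ u ∈ Finset.Icc 4 j, (t r u 1 - t r (u - 1) 1)) := by
    rw [hw, hw, chain_fork (by omega) (by omega) (by omega) _ rfl rfl h2j,
      chain_fork (by omega) (by omega) (by omega) _ rfl rfl h2j]
    simp only [Pi.zero_apply, zero_add]
    simp only [div_one, one_mul, mul_one, sub_zero] at hpf ⊢
    exact hpf
  rw [hsum]

/-- The two paths become the stated fraction after exchanging `t^{(u)}_1` and `t^{(u)}_2` for
`3 ≤ u ≤ i`, which does not affect the symmetrization. -/
theorem isAtom_plus_iff_of_three_le {i j : ℕ} (h1 : 1 ≤ i) (h3 : 3 ≤ i) (hij : i < j)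
    (hj : j ≤ r) (η : RatFun r) :
    IsAtom ⟨true, i, j, h1, hij, hj⟩ η ↔
      η = sym (PosRoot.content ⟨true, i, j, h1, hij, hj⟩)
        ((t r 3 1 - t r 3 2) /
          (t r i 2 * (t r 1 1 - t r 3 2) * (t r 2 1 - t r 3 2) *
            (t r 3 1 - t r 1 1) * (t r 3 1 - t r 2 1) *
            (∏ u ∈ Finset.Icc 3 (i - 1), (t r u 2 - t r (u + 1) 2)) *
            ∏ u ∈ Finset.Icc 4 j, (t r u 1 - t r (u - 1) 1))) := by
  rw [isAtom_plus_iff h1 (by omega) hij hj]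
  set k := PosRoot.content ⟨true, i, j, h1, hij, hj⟩ with hk
  have hk2 : ∀ u : Idx r, 2 ≤ k u ↔ 3 ≤ (u : ℕ) ∧ (u : ℕ) ≤ i := fun u => by
    simp only [hk, PosRoot.content]
    split_ifs <;> first | contradiction | omega
  set σ := permAct (swapVars k) with hσ
  have hσt : ∀ u a, 1 ≤ u → u ≤ r →
      σ (t r u a) = t r u (if 3 ≤ u ∧ u ≤ i then Equiv.swap 1 2 a else a) := fun u a hu hur => by
    have := permAct_swapVars_t k ⟨u, Finset.mem_Icc.mpr ⟨hu, hur⟩⟩ a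
    simpa only [hk2] using this
  have hσ2 : ∀ u, 3 ≤ u → u ≤ i → σ (t r u 1) = t r u 2 := fun u hu hui => by
    rw [hσt u 1 (by omega) (by omega), if_pos ⟨hu, hui⟩, Equiv.swap_apply_left]
  have hσ1 : ∀ u, 1 ≤ u → u ≤ r → σ (t r u ((if 3 ≤ u ∧ u ≤ i then 1 else 0) + 1)) = t r u 1 :=
    fun u hu hur => by
      rw [hσt u _ hu hur]
      split_ifs
      · rw [one_add_one_eq_two, Equiv.swap_apply_right]
      · rfl
  have hσ0 : ∀ u, 1 ≤ u → u < 3 → σ (t r u 1) = t r u 1 := fun u hu hu3 => by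
    rw [hσt u _ hu (by omega), if_neg (by omega)]
  have hchain : ∀ x y, 1 ≤ x → x < 3 → 1 ≤ y → y < 3 → x ≠ y →
      σ (chain r 0 0 (plusWord x y i j)) =
        1 / t r i 2 * (1 / ∏ u ∈ Finset.Icc 3 (i - 1), (t r u 2 - t r (u + 1) 2)) *
          (1 / (t r x 1 - t r 3 2) * (1 / (t r y 1 - t r x 1) * (1 / (t r 3 1 - t r y 1) *
            (1 / ∏ u ∈ Finset.Icc 4 j, (t r u 1 - t r (u - 1) 1))))) := by
    intro x y hx1 hx hy1 hy hxy
    have hi3 : 3 + (i - 3) = i := by omega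
    rw [plusWord, show i - 2 = i - 3 + 1 by omega, chain_range'_reverse_append, hi3,
      chain_fork hx hy hxy _ (by rw [if_neg (by omega)]; rfl) (by rw [if_neg (by omega)]; rfl)
        (by omega)]
    simp only [Pi.zero_apply, zero_add, sub_zero, map_mul, map_div₀, map_one, map_sub, map_prod]
    rw [hσ2 i h3 le_rfl, hσ2 3 le_rfl h3, hσ0 x hx1 hx, hσ0 y hy1 hy, hσ1 3 (by omega) (by omega)]
    have e1 : ∏ u ∈ Finset.Ico 3 i, 1 / (σ (t r u 1) - σ (t r (u + 1) 1)) =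
        1 / ∏ u ∈ Finset.Icc 3 (i - 1), (t r u 2 - t r (u + 1) 2) := by
      rw [← prod_one_div]
      refine Finset.prod_congr ?_ fun u hu => ?_
      · ext u
        simp only [Finset.mem_Icc, Finset.mem_Ico]
        omega
      · rw [Finset.mem_Icc] at hu
        rw [hσ2 u (by omega) (by omega), hσ2 (u + 1) (by omega) (by omega)]
    have e2 : ∏ u ∈ Finset.Icc 4 j,
        (σ (t r u ((if 3 ≤ u ∧ u ≤ i then 1 else 0) + 1)) -
          σ (t r (u - 1) ((if 3 ≤ u - 1 ∧ u - 1 ≤ i then 1 else 0) + 1))) =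
        ∏ u ∈ Finset.Icc 4 j, (t r u 1 - t r (u - 1) 1) := by
      refine Finset.prod_congr rfl fun u hu => ?_
      rw [Finset.mem_Icc] at hu
      rw [hσ1 u (by omega) (by omega), hσ1 (u - 1) (by omega) (by omega)]
    rw [e1, e2]
  rw [← sym_permAct (swapVars k), ← hσ, map_add, hchain 2 1 (by omega) (by omega) (by omega)
    (by omega) (by omega), hchain 1 2 (by omega) (by omega) (by omega) (by omega) (by omega)]
  rw [partial_fractions]
  all_goals exact t_sub_t_ne_zero (by omega) (by omega) (by omega) (by omega) (by omega)

end Atoms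

end TypeD

theorem mainTheorem4 (r : ℕ) :
    -- the atoms at `ε_j - ε_i`
    (∀ (i j : ℕ) (h1 : 1 ≤ i) (hij : i < j) (hj : j ≤ r) (η : TypeD.RatFun r),
      TypeD.IsAtom ⟨false, i, j, h1, hij, hj⟩ η ↔
        η = 1 / (TypeD.t r (i + 1) 1 *
          ∏ u ∈ Finset.Icc (i + 2) j, (TypeD.t r u 1 - TypeD.t r (u - 1) 1))) ∧
    -- the atoms at `ε_j + ε_1`; the variable before `t^{(3)}_1` in the string is `t^{(1)}_1`
    (∀ (j : ℕ) (h1j : 1 < j) (hj : j ≤ r) (η : TypeD.RatFun r),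
      TypeD.IsAtom ⟨true, 1, j, le_rfl, h1j, hj⟩ η ↔
        η = 1 / (TypeD.t r 1 1 *
          ∏ u ∈ Finset.Icc 3 j,
            (TypeD.t r u 1 - TypeD.t r (if u = 3 then 1 else u - 1) 1))) ∧
    -- the atoms at `ε_j + ε_2`
    (∀ (j : ℕ) (h2j : 2 < j) (hj : j ≤ r) (η : TypeD.RatFun r),
      TypeD.IsAtom ⟨true, 2, j, one_le_two, h2j, hj⟩ η ↔
        η = TypeD.sym (TypeD.PosRoot.content ⟨true, 2, j, one_le_two, h2j, hj⟩)
          (TypeD.t r 3 1 /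
            (TypeD.t r 1 1 * TypeD.t r 2 1 *
              (TypeD.t r 3 1 - TypeD.t r 1 1) * (TypeD.t r 3 1 - TypeD.t r 2 1) *
              ∏ u ∈ Finset.Icc 4 j, (TypeD.t r u 1 - TypeD.t r (u - 1) 1)))) ∧
    -- the atoms at `ε_j + ε_i` with `i ≥ 3`
    (∀ (i j : ℕ) (h3 : 3 ≤ i) (hij : i < j) (hj : j ≤ r) (η : TypeD.RatFun r),
      TypeD.IsAtom ⟨true, i, j, by omega, hij, hj⟩ η ↔
        η = TypeD.sym (TypeD.PosRoot.content ⟨true, i, j, by omega, hij, hj⟩)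
          ((TypeD.t r 3 1 - TypeD.t r 3 2) /
            (TypeD.t r i 2 *
              (TypeD.t r 1 1 - TypeD.t r 3 2) * (TypeD.t r 2 1 - TypeD.t r 3 2) *
              (TypeD.t r 3 1 - TypeD.t r 1 1) * (TypeD.t r 3 1 - TypeD.t r 2 1) *
              (∏ u ∈ Finset.Icc 3 (i - 1), (TypeD.t r u 2 - TypeD.t r (u + 1) 2)) *
              ∏ u ∈ Finset.Icc 4 j, (TypeD.t r u 1 - TypeD.t r (u - 1) 1)))) := by
  exact ⟨fun i j h1 hij hj η => TypeD.isAtom_minus_iff h1 hij hj η,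
    fun j h1j hj η => TypeD.isAtom_plus_one_iff h1j hj η,
    fun j h2j hj η => TypeD.isAtom_plus_two_iff one_le_two h2j hj η,
    fun i j h3 hij hj η => TypeD.isAtom_plus_iff_of_three_le (by omega) h3 hij hj η⟩
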